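/- For a smooth immersion $F:U\to\mathbb R^{n+1}$ of an open set $U\subset\mathbb R^n$ and a smooth transversal field $\xi$, write $D_XY=\nabla_XY+h(X,Y)\xi$. If $h$ is nondegenerate, $\xi$ is called the affine (Blaschke) normal when all derivatives of $\xi$ are tangential and $|\det(\partial_1F,\dots,\partial_nF,\xi)|=\sqrt{|\det(h_{ij})|}$; then $h$ is the affine metric, $S$ defined by $D_X\xi=-SX$ is the shape operator, and $K(X,Y)=\nabla_XY-\widehat\nabla_XY$ is the difference tensor, with $\widehat\nabla$ the Levi-Civita connection of $h$. The hypersurface is positive definite if $h$ is positive definite (for the appropriate sign of $\xi$), and it is an improper affine sphere if $S=0$. For a subgroup $G\subset SO(n)$, $F$ admits a pointwise $G$-symmetry if for every $p\in U$ there is an $h$-orthonormal basis of the tangent space at $p$ such that every automorphism of the tangent space whose matrix in this basis lies in $G$ preserves $h$, $K$ and $S$ at $p$. **Theorem.** Let $N\subset\mathbb R^2$ and $I\subset\mathbb R$ be open and let $f:N\to\mathbb R$ be such that $\psi:N\to\mathbb R^3$, $\psi(u,v)=(u,v,f(u,v))$, is an improper affine sphere with affine normal $(0,0,1)$. Let $\gamma=(\gamma_1,\gamma_2):I\to\mathbb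 R^2$ be a smooth curve such that $$F:I\times N\to\mathbb R^4,\qquad F(t,u,v)=\bigl(\gamma_1(t)u,\ \gamma_1(t)v,\ \gamma_1(t)f(u,v)+\gamma_2(t),\ \gamma_1(t)\bigr)$$ defines a positive definite affine hypersurface. Then $F$ admits a pointwise $Z_3$-symmetry or a pointwise $SO(2)$-symmetry, where $SO(2)\subset SO(3)$ is the group of all rotations about the first axis and $Z_3\subset SO(2)$ is generated by the rotation by the angle $2\pi/3$. -/

import Mathlib

open scoped ContDiff

namespace AffineHypersurface

noncomputable section

/-- The partial derivative `∂G/∂xᵢ` of a map `G` defined on (an open subset of) `ℝⁿ`. -/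
def pd {n : ℕ} {E : Type*} [NormedAddCommGroup E] [NormedSpace ℝ E]
    (i : Fin n) (G : (Fin n → ℝ) → E) (p : Fin n → ℝ) : E :=
  fderiv ℝ G p (Pi.single i 1)

/-- The matrix with columns `∂₁F, …, ∂ₙF, ξ` at the point `p`. -/
def frame {n : ℕ} (F ξ : (Fin n → ℝ) → (Fin (n + 1) → ℝ)) (p : Fin n → ℝ) :
    Matrix (Fin (n + 1)) (Fin (n + 1)) ℝ :=
  Matrix.of fun a j =>
    (Fin.snoc (fun i => pd i F p) (ξ p) : Fin (n + 1) → (Fin (n + 1) → ℝ)) j a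

/-- The coefficients `c` in `w = c₁ ∂₁F + ⋯ + cₙ ∂ₙF + cₙ₊₁ ξ` (when `ξ` is transversal at `p`). -/
def frameCoord {n : ℕ} (F ξ : (Fin n → ℝ) → (Fin (n + 1) → ℝ)) (p : Fin n → ℝ)
    (w : Fin (n + 1) → ℝ) : Fin (n + 1) → ℝ :=
  Matrix.mulVec (frame F ξ p)⁻¹ w

/-- The components with respect to `∂₁F, …, ∂ₙF` of the tangential part of `w`. -/
def tangentialPart {n : ℕ} (F ξ : (Fin n → ℝ) → (Fin (n + 1) → ℝ)) (p : Fin n → ℝ)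
    (w : Fin (n + 1) → ℝ) : Fin n → ℝ :=
  fun k => frameCoord F ξ p w k.castSucc

/-- The component of `w` along `ξ`. -/
def transversalPart {n : ℕ} (F ξ : (Fin n → ℝ) → (Fin (n + 1) → ℝ)) (p : Fin n → ℝ)
    (w : Fin (n + 1) → ℝ) : ℝ :=
  frameCoord F ξ p w (Fin.last n)

/-- Christoffel symbols `Γᵢⱼᵏ` of the induced connection `∇`, from
`D_X Y = ∇_X Y + h(X,Y) ξ`. -/
def inducedChristoffel {n : ℕ} (F ξ : (Fin n → ℝ) → (Fin (n + 1) → ℝ)) (p : Fin n → ℝ)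
    (i j k : Fin n) : ℝ :=
  tangentialPart F ξ p (pd i (pd j F) p) k

/-- The bilinear form `h` in `D_X Y = ∇_X Y + h(X,Y) ξ`, as the matrix `hᵢⱼ = h(∂ᵢ,∂ⱼ)`. -/
def metric {n : ℕ} (F ξ : (Fin n → ℝ) → (Fin (n + 1) → ℝ)) (p : Fin n → ℝ) :
    Matrix (Fin n) (Fin n) ℝ :=
  Matrix.of fun i j => transversalPart F ξ p (pd i (pd j F) p)

/-- The shape operator `S`, `D_X ξ = -SX` (for `ξ` with tangential derivatives), as a matrix:
`S ∂ᵢ = ∑ₖ (shape)ₖᵢ ∂ₖ`. -/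
def shape {n : ℕ} (F ξ : (Fin n → ℝ) → (Fin (n + 1) → ℝ)) (p : Fin n → ℝ) :
    Matrix (Fin n) (Fin n) ℝ :=
  Matrix.of fun k i => -tangentialPart F ξ p (pd i ξ p) k

/-- Christoffel symbols `Γ̂ᵢⱼᵏ` of the Levi-Civita connection of the metric `g`. -/
def leviCivitaChristoffel {n : ℕ} (g : (Fin n → ℝ) → Matrix (Fin n) (Fin n) ℝ) (p : Fin n → ℝ)
    (i j k : Fin n) : ℝ :=
  (1 / 2 : ℝ) * ∑ l, (g p)⁻¹ k l *
    (pd i (fun q => g q j l) p + pd j (fun q => g q i l) p - pd l (fun q => g q i j) p)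

/-- The difference tensor `K(X,Y) = ∇_X Y - ∇̂_X Y`. -/
def differenceTensor {n : ℕ} (F ξ : (Fin n → ℝ) → (Fin (n + 1) → ℝ)) (p : Fin n → ℝ)
    (X Y : Fin n → ℝ) : Fin n → ℝ :=
  fun k => ∑ i, ∑ j, X i * Y j *
    (inducedChristoffel F ξ p i j k - leviCivitaChristoffel (metric F ξ) p i j k)

/-- `h(X,Y)` at `p`. -/
def metricForm {n : ℕ} (F ξ : (Fin n → ℝ) → (Fin (n + 1) → ℝ)) (p : Fin n → ℝ)
    (X Y : Fin n → ℝ) : ℝ :=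
  X ⬝ᵥ Matrix.mulVec (metric F ξ p) Y

/-- `SX` at `p`. -/
def shapeOp {n : ℕ} (F ξ : (Fin n → ℝ) → (Fin (n + 1) → ℝ)) (p : Fin n → ℝ)
    (X : Fin n → ℝ) : Fin n → ℝ :=
  Matrix.mulVec (shape F ξ p) X

/-- `F : U → ℝⁿ⁺¹` is a smooth nondegenerate affine hypersurface and `ξ` is its affine (Blaschke)
normal field: `ξ` is transversal, its derivatives are tangential, and the induced volume
`|det(∂₁F, …, ∂ₙF, ξ)|` is the volume `√|det h|` of the affine metric. (On a connected
hypersurface these conditions determine `ξ` up to sign.) -/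
structure IsBlaschkeNormal {n : ℕ} (F : (Fin n → ℝ) → (Fin (n + 1) → ℝ)) (U : Set (Fin n → ℝ))
    (ξ : (Fin n → ℝ) → (Fin (n + 1) → ℝ)) : Prop where
  smooth_immersion : ContDiffOn ℝ ∞ F U
  smooth_normal : ContDiffOn ℝ ∞ ξ U
  transversal : ∀ p ∈ U, (frame F ξ p).det ≠ 0
  nondegenerate : ∀ p ∈ U, (metric F ξ p).det ≠ 0
  equiaffine : ∀ p ∈ U, ∀ i, transversalPart F ξ p (pd i ξ p) = 0
  volume_eq : ∀ p ∈ U, |(frame F ξ p).det| = √|(metric F ξ p).det|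

/-- `F` is an improper affine sphere with affine normal `ξ`: the shape operator vanishes. -/
def IsImproperAffineSphere {n : ℕ} (F : (Fin n → ℝ) → (Fin (n + 1) → ℝ)) (U : Set (Fin n → ℝ))
    (ξ : (Fin n → ℝ) → (Fin (n + 1) → ℝ)) : Prop :=
  IsBlaschkeNormal F U ξ ∧ ∀ p ∈ U, shape F ξ p = 0

/-- `F` is a positive definite affine hypersurface with affine normal `ξ`
(for which the affine metric is positive definite, which fixes the sign of `ξ`). -/
def IsPositiveDefinite {n : ℕ} (F : (Fin n → ℝ) → (Fin (n + 1) → ℝ)) (U : Set (Fin n → ℝ))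
    (ξ : (Fin n → ℝ) → (Fin (n + 1) → ℝ)) : Prop :=
  IsBlaschkeNormal F U ξ ∧ ∀ p ∈ U, (metric F ξ p).PosDef

/-- The endomorphism `A` of the tangent space at `p` preserves `h`, `K` and `S`. -/
def PreservesAt {n : ℕ} (F ξ : (Fin n → ℝ) → (Fin (n + 1) → ℝ)) (p : Fin n → ℝ)
    (A : (Fin n → ℝ) →ₗ[ℝ] (Fin n → ℝ)) : Prop :=
  (∀ X Y, metricForm F ξ p (A X) (A Y) = metricForm F ξ p X Y) ∧
  (∀ X Y, differenceTensor F ξ p (A X) (A Y) = A (differenceTensor F ξ p X Y)) ∧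
  (∀ X, shapeOp F ξ p (A X) = A (shapeOp F ξ p X))

/-- Pointwise `G`-symmetry for a subgroup `G` of `SO(n)`: at every point, `G`, acting on the tangent
space through some `h`-orthonormal basis, preserves `h`, `K` and `S`. -/
def AdmitsPointwiseSymmetry {n : ℕ} (F : (Fin n → ℝ) → (Fin (n + 1) → ℝ)) (U : Set (Fin n → ℝ))
    (ξ : (Fin n → ℝ) → (Fin (n + 1) → ℝ))
    (G : Subgroup (Matrix.specialOrthogonalGroup (Fin n) ℝ)) : Prop :=
  ∀ p ∈ U, ∃ e : Module.Basis (Fin n) ℝ (Fin n → ℝ),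
    (∀ i j, metricForm F ξ p (e i) (e j) = if i = j then 1 else 0) ∧
    ∀ g ∈ G, PreservesAt F ξ p (Matrix.toLin e e (g : Matrix (Fin n) (Fin n) ℝ))

/-- The matrix of the rotation by the angle `θ` about the first axis. -/
def rotationMatrix (θ : ℝ) : Matrix (Fin 3) (Fin 3) ℝ :=
  !![1, 0, 0; 0, Real.cos θ, -Real.sin θ; 0, Real.sin θ, Real.cos θ]

theorem rotationMatrix_mem (θ : ℝ) :
    rotationMatrix θ ∈ Matrix.specialOrthogonalGroup (Fin 3) ℝ := by
  rw [Matrix.mem_specialOrthogonalGroup_iff, Matrix.mem_orthogonalGroup_iff]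
  have h := Real.sin_sq_add_cos_sq θ
  constructor
  · ext i j
    fin_cases i <;> fin_cases j <;>
      simp [rotationMatrix, Matrix.mul_apply, Fin.sum_univ_three] <;> nlinarith
  · simp [rotationMatrix, Matrix.det_fin_three]
    nlinarith

/-- The rotation by the angle `θ` about the first axis, in `SO(3)`. -/
def rotation (θ : ℝ) : Matrix.specialOrthogonalGroup (Fin 3) ℝ :=
  ⟨rotationMatrix θ, rotationMatrix_mem θ⟩

theorem rotation_zero : rotation 0 = 1 := by
  apply Subtype.ext
  ext i j
  fin_cases i <;> fin_cases j <;> simp [rotation, rotationMatrix]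

theorem rotation_add (θ φ : ℝ) : rotation (θ + φ) = rotation θ * rotation φ := by
  apply Subtype.ext
  ext i j
  fin_cases i <;> fin_cases j <;>
    simp [rotation, rotationMatrix, Real.cos_add, Real.sin_add] <;> ring

/-- `Z₃`, generated by the rotation by the angle `2π/3` about the first axis. -/
def Z3 : Subgroup (Matrix.specialOrthogonalGroup (Fin 3) ℝ) :=
  Subgroup.zpowers (rotation (2 * Real.pi / 3))

/-- `SO(2)`, all rotations about the first axis. -/
def SO2 : Subgroup (Matrix.specialOrthogonalGroup (Fin 3) ℝ) where
  carrier := Set.range rotation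
  one_mem' := ⟨0, rotation_zero⟩
  mul_mem' := by
    rintro _ _ ⟨θ, rfl⟩ ⟨φ, rfl⟩
    exact ⟨θ + φ, rotation_add θ φ⟩
  inv_mem' := by
    rintro _ ⟨θ, rfl⟩
    refine ⟨-θ, eq_inv_of_mul_eq_one_left ?_⟩
    rw [← rotation_add, neg_add_cancel, rotation_zero]

/-- The graph immersion `(u, v) ↦ (u, v, f(u,v))`. -/
def graphMap (f : (Fin 2 → ℝ) → ℝ) : (Fin 2 → ℝ) → (Fin 3 → ℝ) :=
  fun q => ![q 0, q 1, f q]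

/-- `(t, u, v) ↦ (γ₁(t) u, γ₁(t) v, γ₁(t) f(u,v) + γ₂(t), γ₁(t))`. -/
def warpedMap (f : (Fin 2 → ℝ) → ℝ) (γ : ℝ → (Fin 2 → ℝ)) : (Fin 3 → ℝ) → (Fin 4 → ℝ) :=
  fun p => ![γ (p 0) 0 * p 1, γ (p 0) 0 * p 2,
    γ (p 0) 0 * f ![p 1, p 2] + γ (p 0) 1, γ (p 0) 0]

/-- The parameter domain `I × N`, with coordinates `(t, u, v)`. -/
def productDomain (I : Set ℝ) (N : Set (Fin 2 → ℝ)) : Set (Fin 3 → ℝ) :=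
  {p | p 0 ∈ I ∧ ![p 1, p 2] ∈ N}

end

end AffineHypersurface

open AffineHypersurface

/-! The `Z₃`-symmetry always holds, whatever the curve. Let `ν` be the linear form that kills the
tangent space of `F` and is 1 on `(0,0,1,0)` (`conormal`), and put `φ = ν(ξ)`. Applying `ν` to
second derivatives shows that `h` is block diagonal: a function of `t` times `dt²`, plus `B = γ₁/φ`
times the Hessian of `f` (`metric_eq`).

The Hessian determinant of `f` is `±1`, and definiteness of `h` selects `+1`. The volume condition
then becomes `φ⁵ γ₁² γ₁'² = γ₂'' - (γ₂'/γ₁') γ₁''` (`conormal_pow_five`), so `φ` depends on `t`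
only. Since `ν(∂ᵢξ) = 0`, the derivatives of `φ` see only the coefficients of `ν`. In the `u, v`
directions they must vanish, which fixes the direction of `(ξ₀, ξ₁)`; in the `t` direction they
express `ξ₃` through `t`. Hence `ξ` is again a warped map over `f` (`exists_normal_eq`).

With such a `ξ`, the shape operator is `diag(s₀, s₁, s₁)`, and the lowered difference tensor is
built from `dt` and the plane block of `h`, except for the cubic `-(B/2) f_{ijk}`. Differentiating
the constant Hessian determinant shows that this cubic is apolar to the metric (`hessian_apolar`).
An apolar binary cubic is the real part of a multiple of `z³` in orthonormal coordinates, so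
rotation by `2π/3` preserves it (`cubicForm_planeRotation`). -/

namespace AffineHypersurface

/-! ### Calculus of partial derivatives -/

/-- `G` is differentiable at `q`, with partial derivative `∂G/∂xᵢ = v` there. -/
def HasPD {n : ℕ} {E : Type*} [NormedAddCommGroup E] [NormedSpace ℝ E]
    (i : Fin n) (G : (Fin n → ℝ) → E) (v : E) (q : Fin n → ℝ) : Prop :=
  DifferentiableAt ℝ G q ∧ pd i G q = v

namespace HasPD

variable {n : ℕ} {i : Fin n} {q : Fin n → ℝ}

theorem of_differentiableAt {E : Type*} [NormedAddCommGroup E] [NormedSpace ℝ E]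
    {G : (Fin n → ℝ) → E} (h : DifferentiableAt ℝ G q) (i : Fin n) : HasPD i G (pd i G q) q :=
  ⟨h, rfl⟩

/-- Second derivatives are found by differentiating a formula for the first derivative; that formula
is available only on the open domain. -/
theorem congr_on {E : Type*} [NormedAddCommGroup E] [NormedSpace ℝ E]
    {G H : (Fin n → ℝ) → E} {v : E} {U : Set (Fin n → ℝ)} (h : HasPD i G v q) (hU : IsOpen U)
    (hq : q ∈ U) (heq : ∀ x ∈ U, H x = G x) : HasPD i H v q := by
  have e : H =ᶠ[nhds q] G := Filter.eventuallyEq_of_mem (hU.mem_nhds hq) heq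
  refine ⟨h.1.congr_of_eventuallyEq e, ?_⟩
  rw [← h.2, pd, pd, e.fderiv_eq]

theorem congr_value {E : Type*} [NormedAddCommGroup E] [NormedSpace ℝ E]
    {G : (Fin n → ℝ) → E} {v w : E} (h : HasPD i G v q) (hw : w = v) : HasPD i G w q :=
  hw ▸ h

theorem const {E : Type*} [NormedAddCommGroup E] [NormedSpace ℝ E] (c : E) :
    HasPD i (fun _ => c) 0 q := by
  refine ⟨differentiableAt_const c, ?_⟩
  simp [pd]

theorem add {G H : (Fin n → ℝ) → ℝ} {v w : ℝ} (hG : HasPD i G v q) (hH : HasPD i H w q) :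
    HasPD i (fun x => G x + H x) (v + w) q := by
  refine ⟨hG.1.add hH.1, ?_⟩
  rw [← hG.2, ← hH.2, pd, fderiv_fun_add hG.1 hH.1]
  rfl

theorem sub {G H : (Fin n → ℝ) → ℝ} {v w : ℝ} (hG : HasPD i G v q) (hH : HasPD i H w q) :
    HasPD i (fun x => G x - H x) (v - w) q := by
  refine ⟨hG.1.sub hH.1, ?_⟩
  rw [← hG.2, ← hH.2, pd, fderiv_fun_sub hG.1 hH.1]
  rfl

theorem mul {G H : (Fin n → ℝ) → ℝ} {v w : ℝ} (hG : HasPD i G v q) (hH : HasPD i H w q) :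
    HasPD i (fun x => G x * H x) (v * H q + G q * w) q := by
  refine ⟨hG.1.mul hH.1, ?_⟩
  rw [← hG.2, ← hH.2, pd, fderiv_fun_mul hG.1 hH.1]
  simp [pd]
  ring

theorem pi {m : ℕ} {G : (Fin n → ℝ) → (Fin m → ℝ)} {v : Fin m → ℝ}
    (h : ∀ a, HasPD i (fun x => G x a) (v a) q) : HasPD i G v q := by
  have hd : DifferentiableAt ℝ G q := differentiableAt_pi.2 fun a => (h a).1
  refine ⟨hd, ?_⟩
  funext a
  rw [← (h a).2, pd, pd, fderiv_pi fun a => (h a).1]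
  rfl

theorem apply {m : ℕ} {G : (Fin n → ℝ) → (Fin m → ℝ)} {v : Fin m → ℝ}
    (h : HasPD i G v q) (a : Fin m) : HasPD i (fun x => G x a) (v a) q := by
  have hd : ∀ a, DifferentiableAt ℝ (fun x => G x a) q := differentiableAt_pi.1 h.1
  refine ⟨hd a, ?_⟩
  rw [← h.2, pd, pd]
  conv_rhs => rw [fderiv_pi hd]
  rfl

theorem coord (i j : Fin n) : HasPD i (fun x : Fin n → ℝ => x j) (if j = i then 1 else 0) q := by
  have h : HasFDerivAt (fun x : Fin n → ℝ => x j) (ContinuousLinearMap.proj (R := ℝ) j) q :=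
    (ContinuousLinearMap.proj (R := ℝ) (φ := fun _ : Fin n => ℝ) j).hasFDerivAt
  refine ⟨h.differentiableAt, ?_⟩
  rw [pd, h.fderiv]
  simp [Pi.single_apply]

theorem comp_coord {E : Type*} [NormedAddCommGroup E] [NormedSpace ℝ E] {g : ℝ → E} {g' : E}
    (j : Fin n) (h : HasDerivAt g g' (q j)) :
    HasPD i (fun x => g (x j)) ((if j = i then 1 else 0 : ℝ) • g') q := by
  have h0 : HasFDerivAt (fun x : Fin n → ℝ => x j) (ContinuousLinearMap.proj (R := ℝ) j) q :=
    (ContinuousLinearMap.proj (R := ℝ) (φ := fun _ : Fin n => ℝ) j).hasFDerivAt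
  have h1 := HasFDerivAt.comp q h.hasFDerivAt h0
  refine ⟨h1.differentiableAt, ?_⟩
  have := h1.fderiv
  rw [Function.comp_def] at this
  rw [pd, this]
  simp [Pi.single_apply]

end HasPD

theorem hasFDerivAt_tail (q : Fin 3 → ℝ) :
    HasFDerivAt (fun x : Fin 3 → ℝ => (![x 1, x 2] : Fin 2 → ℝ))
      (ContinuousLinearMap.pi ![ContinuousLinearMap.proj (R := ℝ) (φ := fun _ : Fin 3 => ℝ) 1,
        ContinuousLinearMap.proj 2]) q := by
  rw [hasFDerivAt_pi']
  intro a
  fin_cases a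
  · exact (ContinuousLinearMap.proj (R := ℝ) (φ := fun _ : Fin 3 => ℝ) 1).hasFDerivAt
  · exact (ContinuousLinearMap.proj (R := ℝ) (φ := fun _ : Fin 3 => ℝ) 2).hasFDerivAt

theorem HasPD.comp_tail {k : (Fin 2 → ℝ) → ℝ} {q : Fin 3 → ℝ}
    (h : DifferentiableAt ℝ k ![q 1, q 2]) (i : Fin 3) :
    HasPD i (fun x => k ![x 1, x 2])
      ((![0, pd 0 k ![q 1, q 2], pd 1 k ![q 1, q 2]] : Fin 3 → ℝ) i) q := by
  have h1 := HasFDerivAt.comp q (f := fun x : Fin 3 → ℝ => (![x 1, x 2] : Fin 2 → ℝ))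
    h.hasFDerivAt (hasFDerivAt_tail q)
  refine ⟨h1.differentiableAt, ?_⟩
  have := h1.fderiv
  rw [Function.comp_def] at this
  rw [pd, this]
  simp only [ContinuousLinearMap.comp_apply]
  fin_cases i
  · refine Eq.trans (congrArg (fderiv ℝ k ![q 1, q 2]) ?_) (map_zero (fderiv ℝ k ![q 1, q 2]))
    ext a; fin_cases a <;> simp
  · simp only [pd]
    congr 1
    ext a; fin_cases a <;> simp
  · simp only [pd]
    congr 1
    ext a; fin_cases a <;> simp

theorem contDiffOn_pd {n : ℕ} {E : Type*} [NormedAddCommGroup E] [NormedSpace ℝ E]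
    {G : (Fin n → ℝ) → E} {U : Set (Fin n → ℝ)} (hG : ContDiffOn ℝ ∞ G U) (hU : IsOpen U)
    (i : Fin n) : ContDiffOn ℝ ∞ (pd i G) U := by
  have h : ContDiffOn ℝ ∞ (fderiv ℝ G) U := hG.fderiv_of_isOpen hU (by simp)
  exact h.clm_apply contDiffOn_const

theorem contDiffOn_deriv {E : Type*} [NormedAddCommGroup E] [NormedSpace ℝ E]
    {g : ℝ → E} {I : Set ℝ} (hg : ContDiffOn ℝ ∞ g I) (hI : IsOpen I) :
    ContDiffOn ℝ ∞ (deriv g) I :=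
  hg.deriv_of_isOpen hI (by simp)

theorem differentiableAt_of_contDiffOn {E F : Type*} [NormedAddCommGroup E] [NormedSpace ℝ E]
    [NormedAddCommGroup F] [NormedSpace ℝ F] {g : E → F} {U : Set E} {x : E}
    (hg : ContDiffOn ℝ ∞ g U) (hU : IsOpen U) (hx : x ∈ U) : DifferentiableAt ℝ g x :=
  (hg.contDiffAt (hU.mem_nhds hx)).differentiableAt (by simp)

/-- Second partial derivatives of smooth functions commute. -/
theorem pd_comm {n : ℕ} {E : Type*} [NormedAddCommGroup E] [NormedSpace ℝ E]
    {G : (Fin n → ℝ) → E} {U : Set (Fin n → ℝ)} (hG : ContDiffOn ℝ ∞ G U) (hU : IsOpen U)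
    {q : Fin n → ℝ} (hq : q ∈ U) (i j : Fin n) : pd i (pd j G) q = pd j (pd i G) q := by
  have hs : IsSymmSndFDerivAt ℝ G q :=
    (hG.contDiffAt (hU.mem_nhds hq)).isSymmSndFDerivAt
      (by simpa using WithTop.coe_le_coe.2 (le_top : (2 : ℕ∞) ≤ ⊤))
  have hd : DifferentiableAt ℝ (fderiv ℝ G) q :=
    differentiableAt_of_contDiffOn (hG.fderiv_of_isOpen hU (m := ∞) (by simp)) hU hq
  have key : ∀ i j : Fin n, pd i (pd j G) q
      = fderiv ℝ (fderiv ℝ G) q (Pi.single i 1) (Pi.single j 1) := by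
    intro i j
    have : pd j G = fun x => fderiv ℝ G x (Pi.single j 1) := rfl
    rw [this, pd, fderiv_clm_apply hd (differentiableAt_const _)]
    simp
  rw [key, key, hs]

/-! ### Coordinates in the moving frame -/

theorem frameCoord_eq {n : ℕ} {F ξ : (Fin n → ℝ) → (Fin (n + 1) → ℝ)} {p : Fin n → ℝ}
    (h : (frame F ξ p).det ≠ 0) {w c : Fin (n + 1) → ℝ}
    (hc : Matrix.mulVec (frame F ξ p) c = w) : frameCoord F ξ p w = c := by
  rw [frameCoord, ← hc, Matrix.mulVec_mulVec,
    Matrix.nonsing_inv_mul _ (isUnit_iff_ne_zero.2 h), Matrix.one_mulVec]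

theorem frame_mulVec_frameCoord {n : ℕ} {F ξ : (Fin n → ℝ) → (Fin (n + 1) → ℝ)} {p : Fin n → ℝ}
    (h : (frame F ξ p).det ≠ 0) (w : Fin (n + 1) → ℝ) :
    Matrix.mulVec (frame F ξ p) (frameCoord F ξ p w) = w := by
  rw [frameCoord, Matrix.mulVec_mulVec, Matrix.mul_nonsing_inv _ (isUnit_iff_ne_zero.2 h),
    Matrix.one_mulVec]

/-- The difference tensor with its upper index lowered by the metric. -/
theorem metricForm_differenceTensor {n : ℕ} {F ξ : (Fin n → ℝ) → (Fin (n + 1) → ℝ)}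
    {p : Fin n → ℝ} (hdet : (metric F ξ p).det ≠ 0) (hsymm : (metric F ξ p).IsSymm)
    (X Y Z : Fin n → ℝ) :
    metricForm F ξ p (differenceTensor F ξ p X Y) Z = ∑ i, ∑ j, ∑ k, X i * Y j * Z k *
      ((∑ l, metric F ξ p k l * inducedChristoffel F ξ p i j l) - (1 / 2 : ℝ) *
        (pd i (fun q => metric F ξ q j k) p + pd j (fun q => metric F ξ q i k) p
          - pd k (fun q => metric F ξ q i j) p)) := by
  -- Lowering the index cancels the inverse metric in the Levi-Civita symbols, so no inverse matrix
  -- has to be computed later.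
  have hinv : ∀ i j k, ∑ l, metric F ξ p k l * leviCivitaChristoffel (metric F ξ) p i j l
      = (1 / 2 : ℝ) * (pd i (fun q => metric F ξ q j k) p + pd j (fun q => metric F ξ q i k) p
          - pd k (fun q => metric F ξ q i j) p) := by
    intro i j k
    set c : Fin n → ℝ := fun l => pd i (fun q => metric F ξ q j l) p
      + pd j (fun q => metric F ξ q i l) p - pd l (fun q => metric F ξ q i j) p with hc
    have h1 : (metric F ξ p).mulVec ((metric F ξ p)⁻¹.mulVec c) = c := by
      rw [Matrix.mulVec_mulVec, Matrix.mul_nonsing_inv _ (isUnit_iff_ne_zero.2 hdet),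
        Matrix.one_mulVec]
    have h2 := congrFun h1 k
    change _ = 1 / 2 * c k
    rw [← h2]
    simp only [Matrix.mulVec, dotProduct, leviCivitaChristoffel, Finset.mul_sum]
    refine Finset.sum_congr rfl fun l _ => Finset.sum_congr rfl fun m _ => ?_
    simp only [hc]
    ring
  simp only [← hinv, ← Finset.sum_sub_distrib, ← mul_sub]
  simp only [metricForm, dotProduct, Matrix.mulVec, differenceTensor, Finset.sum_mul,
    Finset.mul_sum]
  rw [Finset.sum_comm]
  have e : ∀ l k, metric F ξ p l k = metric F ξ p k l := fun l k => hsymm.apply _ _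
  calc _ = ∑ k, ∑ l, ∑ i, ∑ j, X i * Y j * Z k * (metric F ξ p k l *
          (inducedChristoffel F ξ p i j l - leviCivitaChristoffel (metric F ξ) p i j l)) := by
        refine Finset.sum_congr rfl fun k _ => Finset.sum_congr rfl fun l _ =>
          Finset.sum_congr rfl fun i _ => Finset.sum_congr rfl fun j _ => ?_
        rw [e l k]; ring
    _ = ∑ k, ∑ i, ∑ j, ∑ l, X i * Y j * Z k * (metric F ξ p k l *
          (inducedChristoffel F ξ p i j l - leviCivitaChristoffel (metric F ξ) p i j l)) := by
        refine Finset.sum_congr rfl fun k _ => ?_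
        rw [Finset.sum_comm]
        exact Finset.sum_congr rfl fun i _ => Finset.sum_comm
    _ = _ := by
        rw [Finset.sum_comm]
        exact Finset.sum_congr rfl fun i _ => Finset.sum_comm


/-! ### Linear algebra of the symmetry at a point -/

theorem rotation_zpow (θ : ℝ) (k : ℤ) : rotation θ ^ k = rotation (k * θ) := by
  induction k using Int.induction_on with
  | zero => simp [rotation_zero]
  | succ k ih =>
    rw [zpow_add_one, ih, ← rotation_add]
    congr 1; push_cast; ring
  | pred k ih =>
    rw [zpow_sub_one, ih, mul_inv_eq_iff_eq_mul, ← rotation_add]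
    congr 1; push_cast; ring

/-- The elements of `Z₃` are the rotations whose angle `θ` satisfies `e^{3iθ} = 1`. -/
theorem exists_of_mem_Z3 {g : Matrix.specialOrthogonalGroup (Fin 3) ℝ} (hg : g ∈ Z3) :
    ∃ c s : ℝ, (g : Matrix (Fin 3) (Fin 3) ℝ) = !![1, 0, 0; 0, c, -s; 0, s, c] ∧
      c ^ 2 + s ^ 2 = 1 ∧ c ^ 3 - 3 * c * s ^ 2 = 1 ∧ 3 * c ^ 2 * s - s ^ 3 = 0 := by
  obtain ⟨k, rfl⟩ := Subgroup.mem_zpowers_iff.1 hg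
  set θ : ℝ := k * (2 * Real.pi / 3) with hθ
  have h3 : 3 * θ = k * (2 * Real.pi) := by rw [hθ]; ring
  have h1 : Real.cos (3 * θ) = 1 := by rw [h3]; exact Real.cos_int_mul_two_pi k
  have h2 : Real.sin (3 * θ) = 0 := by
    rw [h3, show (k : ℝ) * (2 * Real.pi) = ((2 * k : ℤ) : ℝ) * Real.pi by push_cast; ring]
    exact Real.sin_int_mul_pi _
  have h4 := Real.cos_sq_add_sin_sq θ
  refine ⟨Real.cos θ, Real.sin θ, ?_, h4, ?_, ?_⟩
  · rw [rotation_zpow]; rfl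
  · rw [Real.cos_three_mul] at h1
    linear_combination h1 - 3 * Real.cos θ * h4
  · rw [Real.sin_three_mul] at h2
    linear_combination h2 + 3 * Real.sin θ * h4

/-- A cubic form in two variables, polarized, with coefficients `a₀, a₁, a₂, a₃`. -/
def cubicForm (a : Fin 4 → ℝ) (X Y Z : Fin 3 → ℝ) : ℝ :=
  a 0 * X 1 * Y 1 * Z 1 + a 1 * (X 1 * Y 1 * Z 2 + X 1 * Y 2 * Z 1 + X 2 * Y 1 * Z 1)
    + a 2 * (X 1 * Y 2 * Z 2 + X 2 * Y 1 * Z 2 + X 2 * Y 2 * Z 1) + a 3 * X 2 * Y 2 * Z 2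

/-- A quadratic form in two variables, polarized. -/
def planeForm (G₁ G₂ G₃ : ℝ) (X Y : Fin 3 → ℝ) : ℝ :=
  G₁ * X 1 * Y 1 + G₂ * (X 1 * Y 2 + X 2 * Y 1) + G₃ * X 2 * Y 2

/-- The map `c + s J` on the last two coordinates, where `J` is the rotation by a right angle for
the quadratic form with coefficients `G₁, G₂, G₃` and determinant `d²`. -/
noncomputable def planeRotation (G₁ G₂ G₃ d c s : ℝ) (X : Fin 3 → ℝ) : Fin 3 → ℝ :=
  ![X 0, c * X 1 + s * (-G₂ * X 1 - G₃ * X 2) / d, c * X 2 + s * (G₁ * X 1 + G₂ * X 2) / d]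

section

variable {G₁ G₂ G₃ d c s : ℝ}

/-- `J` is skew for the quadratic form and `J² = -1`, so `c + sJ` is an isometry as soon as `c² + s²
= 1`. -/
theorem planeForm_planeRotation (hd : d ≠ 0) (hd2 : d ^ 2 = G₁ * G₃ - G₂ ^ 2)
    (hcs : c ^ 2 + s ^ 2 = 1) (X Y : Fin 3 → ℝ) :
    planeForm G₁ G₂ G₃ (planeRotation G₁ G₂ G₃ d c s X) (planeRotation G₁ G₂ G₃ d c s Y)
      = planeForm G₁ G₂ G₃ X Y := by
  simp only [planeForm, planeRotation, Matrix.cons_val]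
  field_simp
  linear_combination (G₁ * X 1 * Y 1 + G₂ * (X 1 * Y 2 + X 2 * Y 1) + G₃ * X 2 * Y 2)
    * (d ^ 2 * hcs - s ^ 2 * hd2)

/-- A cubic form apolar to a quadratic form is invariant under the rotations of order three. -/
theorem cubicForm_planeRotation (hd : d ≠ 0) (hd2 : d ^ 2 = G₁ * G₃ - G₂ ^ 2)
    (h1 : c ^ 3 - 3 * c * s ^ 2 = 1) (h2 : 3 * c ^ 2 * s - s ^ 3 = 0) {a : Fin 4 → ℝ}
    (ha : G₃ * a 0 - 2 * G₂ * a 1 + G₁ * a 2 = 0) (hb : G₃ * a 1 - 2 * G₂ * a 2 + G₁ * a 3 = 0)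
    (X Y Z : Fin 3 → ℝ) :
    cubicForm a (planeRotation G₁ G₂ G₃ d c s X) (planeRotation G₁ G₂ G₃ d c s Y)
      (planeRotation G₁ G₂ G₃ d c s Z) = cubicForm a X Y Z := by
  set J : (Fin 3 → ℝ) → (Fin 3 → ℝ) := fun X =>
    ![0, (-G₂ * X 1 - G₃ * X 2) / d, (G₁ * X 1 + G₂ * X 2) / d] with hJ
  have hT : ∀ X Y Z : Fin 3 → ℝ, cubicForm a (planeRotation G₁ G₂ G₃ d c s X) Y Z
      = c * cubicForm a X Y Z + s * cubicForm a (J X) Y Z := by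
    intro X Y Z
    simp only [cubicForm, planeRotation, hJ, Matrix.cons_val]
    ring
  have s1 : ∀ X Y Z, cubicForm a X Y Z = cubicForm a Y X Z := by
    intro X Y Z; simp only [cubicForm]; ring
  have s2 : ∀ X Y Z, cubicForm a X Y Z = cubicForm a Z Y X := by
    intro X Y Z; simp only [cubicForm]; ring
  have s3 : ∀ X Y Z, cubicForm a X Y Z = cubicForm a X Z Y := by
    intro X Y Z; simp only [cubicForm]; ring
  -- Apolarity enters here: it says exactly that `J` may be moved from one slot of the cubic to
  -- another.
  have hJ1 : ∀ X Y Z, cubicForm a Y (J X) Z = cubicForm a (J Y) X Z := by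
    intro X Y Z
    simp only [cubicForm, hJ, Matrix.cons_val]
    field_simp
    linear_combination (X 1 * Y 2 - X 2 * Y 1) * (Z 1 * ha + Z 2 * hb)
  have hJ2 : ∀ X Y Z, cubicForm a Z Y (J X) = cubicForm a (J Z) Y X := by
    intro X Y Z
    rw [s3, hJ1, s3]
  have hJJ : ∀ X Y Z, cubicForm a (J (J X)) Y Z = -cubicForm a X Y Z := by
    intro X Y Z
    have e1 : J (J X) 1 = - X 1 := by
      simp only [hJ, Matrix.cons_val]
      field_simp
      linear_combination X 1 * hd2
    have e2 : J (J X) 2 = - X 2 := by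
      simp only [hJ, Matrix.cons_val]
      field_simp
      linear_combination X 2 * hd2
    simp only [cubicForm, e1, e2]
    ring
  have hT2 : ∀ X Y Z : Fin 3 → ℝ, cubicForm a X (planeRotation G₁ G₂ G₃ d c s Y) Z
      = c * cubicForm a X Y Z + s * cubicForm a (J X) Y Z := by
    intro X Y Z
    rw [s1, hT, s1 Y, s1 (J Y), hJ1]
  have hT3 : ∀ X Y Z : Fin 3 → ℝ, cubicForm a X Y (planeRotation G₁ G₂ G₃ d c s Z)
      = c * cubicForm a X Y Z + s * cubicForm a (J X) Y Z := by
    intro X Y Z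
    rw [s2, hT, s2 Z, s2 (J Z), hJ2]
  -- With every `J` collected in the first slot, the expression is `(c + sJ)³` there; by `J² = -1`
  -- this equals `(c³ - 3cs²) + (3c²s - s³)J`, which is the identity.
  rw [hT]
  simp only [hT2, hT3, hJJ]
  linear_combination cubicForm a X Y Z * h1 + cubicForm a (J X) Y Z * h2

/-- An orthonormal basis adapted to the splitting of a block diagonal metric, in which the rotations
about the first axis are the maps `planeRotation`. -/
theorem exists_adapted_basis {A : ℝ} (hA : 0 < A) (hG : 0 < G₁) (hd : 0 < d)
    (hd2 : d ^ 2 = G₁ * G₃ - G₂ ^ 2) :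
    ∃ e : Module.Basis (Fin 3) ℝ (Fin 3 → ℝ),
      (∀ i j, A * e i 0 * e j 0 + planeForm G₁ G₂ G₃ (e i) (e j) = if i = j then 1 else 0) ∧
      ∀ (c s : ℝ) (X : Fin 3 → ℝ),
        Matrix.toLin e e !![1, 0, 0; 0, c, -s; 0, s, c] X = planeRotation G₁ G₂ G₃ d c s X := by
  set α := √A with hα
  set β := √G₁ with hβ
  have hα0 : 0 < α := Real.sqrt_pos.2 hA
  have hβ0 : 0 < β := Real.sqrt_pos.2 hG
  have hα2 : α ^ 2 = A := Real.sq_sqrt hA.le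
  have hβ2 : β ^ 2 = G₁ := Real.sq_sqrt hG.le
  clear_value α β
  have hG3 : G₃ = (d ^ 2 + G₂ ^ 2) / β ^ 2 := by
    rw [hβ2]; field_simp; linarith
  -- The third vector is `J` applied to the second, which makes the basis orthonormal and turns `c +
  -- sJ` into the standard rotation matrix.
  set v : Fin 3 → (Fin 3 → ℝ) :=
    ![![1 / α, 0, 0], ![0, 1 / β, 0], ![0, -G₂ / (β * d), β / d]] with hv
  have hli : LinearIndependent ℝ v := by
    rw [Fintype.linearIndependent_iff]
    intro g hg
    have h0 := congrFun hg 0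
    have h1 := congrFun hg 1
    have h2 := congrFun hg 2
    simp [hv, Fin.sum_univ_three, hα0.ne', hβ0.ne', hd.ne'] at h0 h1 h2
    simp [h2, hβ0.ne'] at h1
    intro i; fin_cases i <;> assumption
  have hcard : Fintype.card (Fin 3) = Module.finrank ℝ (Fin 3 → ℝ) := by simp
  set e := basisOfLinearIndependentOfCardEqFinrank hli hcard with he
  have hev : ∀ i, e i = v i := fun i => by
    rw [he, coe_basisOfLinearIndependentOfCardEqFinrank]
  refine ⟨e, ?_, ?_⟩
  · intro i j
    rw [hev, hev, ← hα2, ← hβ2, hG3]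
    fin_cases i <;> fin_cases j <;> simp [hv, planeForm] <;> field_simp <;> ring
  · intro c s
    let T : (Fin 3 → ℝ) →ₗ[ℝ] (Fin 3 → ℝ) :=
      { toFun := planeRotation G₁ G₂ G₃ d c s
        map_add' := by
          intro X Y; ext i; fin_cases i <;> simp [planeRotation] <;> ring
        map_smul' := by
          intro r X; ext i; fin_cases i <;> simp [planeRotation] <;> ring }
    suffices h : Matrix.toLin e e !![1, 0, 0; 0, c, -s; 0, s, c] = T by
      intro X; rw [h]; rfl
    refine e.ext fun i => ?_
    rw [Matrix.toLin_self]
    change _ = planeRotation G₁ G₂ G₃ d c s (e i)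
    simp only [Fin.sum_univ_three, hev]
    rw [← hβ2, hG3]
    ext k
    fin_cases i <;> fin_cases k <;> simp [hv, planeRotation] <;>
      field_simp <;> ring_nf <;> simp

end

/-- The pointwise `Z₃`-symmetry of a hypersurface whose metric, shape operator and lowered
difference tensor are adapted to the splitting `ℝ ⊕ ℝ²`. -/
theorem exists_basis_Z3_preservesAt {F ξ : (Fin 3 → ℝ) → (Fin 4 → ℝ)} {p : Fin 3 → ℝ}
    {A G₁ G₂ G₃ s₀ s₁ k₀ k₁ k₂ : ℝ} {a : Fin 4 → ℝ}
    (hpos : (metric F ξ p).PosDef)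
    (hmetric : metric F ξ p = !![A, 0, 0; 0, G₁, G₂; 0, G₂, G₃])
    (hshape : shape F ξ p = !![s₀, 0, 0; 0, s₁, 0; 0, 0, s₁])
    (hK : ∀ X Y Z, metricForm F ξ p (differenceTensor F ξ p X Y) Z =
      k₀ * X 0 * Y 0 * Z 0 + k₁ * (X 0 * planeForm G₁ G₂ G₃ Y Z + Y 0 * planeForm G₁ G₂ G₃ X Z)
        + k₂ * planeForm G₁ G₂ G₃ X Y * Z 0 + cubicForm a X Y Z)
    (ha : G₃ * a 0 - 2 * G₂ * a 1 + G₁ * a 2 = 0)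
    (hb : G₃ * a 1 - 2 * G₂ * a 2 + G₁ * a 3 = 0) :
    ∃ e : Module.Basis (Fin 3) ℝ (Fin 3 → ℝ),
      (∀ i j, metricForm F ξ p (e i) (e j) = if i = j then 1 else 0) ∧
      ∀ g ∈ Z3, PreservesAt F ξ p (Matrix.toLin e e (g : Matrix (Fin 3) (Fin 3) ℝ)) := by
  have hA : 0 < A := by simpa [hmetric] using hpos.diag_pos (i := 0)
  have hG : 0 < G₁ := by simpa [hmetric] using hpos.diag_pos (i := 1)
  have hD : 0 < G₁ * G₃ - G₂ ^ 2 := by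
    have h := hpos.det_pos
    rw [hmetric, Matrix.det_fin_three] at h
    simp at h
    refine pos_of_mul_pos_right (a := A) ?_ hA.le
    linarith
  have hd : 0 < √(G₁ * G₃ - G₂ ^ 2) := Real.sqrt_pos.2 hD
  have hd2 : √(G₁ * G₃ - G₂ ^ 2) ^ 2 = G₁ * G₃ - G₂ ^ 2 := Real.sq_sqrt hD.le
  generalize √(G₁ * G₃ - G₂ ^ 2) = d at hd hd2
  have hform : ∀ X Y, metricForm F ξ p X Y = A * X 0 * Y 0 + planeForm G₁ G₂ G₃ X Y := by
    intro X Y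
    simp [metricForm, hmetric, dotProduct, Matrix.mulVec, Fin.sum_univ_three, planeForm]
    ring
  obtain ⟨e, he, hrot⟩ := exists_adapted_basis hA hG hd hd2
  refine ⟨e, fun i j => by rw [hform, he], fun g hg => ?_⟩
  obtain ⟨c, s, hgm, hcs, h1, h2⟩ := exists_of_mem_Z3 hg
  rw [hgm]
  have hT0 : ∀ X : Fin 3 → ℝ, planeRotation G₁ G₂ G₃ d c s X 0 = X 0 := fun X => rfl
  have hinv : ∀ X Y, metricForm F ξ p (planeRotation G₁ G₂ G₃ d c s X)
      (planeRotation G₁ G₂ G₃ d c s Y) = metricForm F ξ p X Y := by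
    intro X Y
    rw [hform, hform, planeForm_planeRotation hd.ne' hd2 hcs, hT0, hT0]
  -- The inverse is the rotation with `-s`. Test vectors may therefore be taken rotated, and the
  -- equation for `K` reduces to invariance of its lowered form.
  have hsurj : ∀ Z, ∃ W, planeRotation G₁ G₂ G₃ d c s W = Z := by
    intro Z
    refine ⟨planeRotation G₁ G₂ G₃ d c (-s) Z, ?_⟩
    have hd' := hd.ne'
    ext i
    fin_cases i
    · rfl
    · simp only [planeRotation, Matrix.cons_val, Fin.mk_one]
      field_simp
      linear_combination Z 1 * d ^ 2 * hcs - s ^ 2 * Z 1 * hd2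
    · simp only [planeRotation, Matrix.cons_val, Fin.reduceFinMk]
      field_simp
      linear_combination Z 2 * d ^ 2 * hcs - s ^ 2 * Z 2 * hd2
  refine ⟨fun X Y => by rw [hrot, hrot, hinv], fun X Y => ?_, fun X => ?_⟩
  · rw [hrot, hrot, hrot]
    set V := differenceTensor F ξ p (planeRotation G₁ G₂ G₃ d c s X)
      (planeRotation G₁ G₂ G₃ d c s Y) with hV
    set W := planeRotation G₁ G₂ G₃ d c s (differenceTensor F ξ p X Y) with hW
    have hVW : ∀ Z, metricForm F ξ p V Z = metricForm F ξ p W Z := by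
      intro Z
      obtain ⟨Z, rfl⟩ := hsurj Z
      rw [hW, hinv, hV, hK, hK]
      simp only [hT0, planeForm_planeRotation hd.ne' hd2 hcs,
        cubicForm_planeRotation hd.ne' hd2 h1 h2 ha hb]
    have hzero : metricForm F ξ p (V - W) (V - W) = 0 := by
      have : metricForm F ξ p (V - W) (V - W)
          = metricForm F ξ p V (V - W) - metricForm F ξ p W (V - W) := by
        simp only [metricForm, sub_dotProduct]
      rw [this, hVW, sub_self]
    by_contra hne
    have := hpos.dotProduct_mulVec_pos (sub_ne_zero.2 hne)
    simp only [star_trivial] at this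
    exact this.ne' hzero
  · rw [hrot, hrot]
    ext i
    fin_cases i <;>
      simp [shapeOp, hshape, Matrix.mulVec, dotProduct, Fin.sum_univ_three, planeRotation] <;> ring


/-! ### Transversal components -/

theorem frame_mulVec_apply {n : ℕ} (F ξ : (Fin n → ℝ) → (Fin (n + 1) → ℝ)) (p : Fin n → ℝ)
    (c : Fin (n + 1) → ℝ) :
    Matrix.mulVec (frame F ξ p) c
      = (∑ i : Fin n, c i.castSucc • pd i F p) + c (Fin.last n) • ξ p := by
  ext a
  simp [Matrix.mulVec, dotProduct, Fin.sum_univ_castSucc, frame, mul_comm]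

/-- A linear form that vanishes on the tangent space computes transversal components. -/
theorem transversalPart_mul {n : ℕ} {F ξ : (Fin n → ℝ) → (Fin (n + 1) → ℝ)} {p : Fin n → ℝ}
    (h : (frame F ξ p).det ≠ 0) {ν : (Fin (n + 1) → ℝ) → ℝ} (hν : IsLinearMap ℝ ν)
    (h0 : ∀ i, ν (pd i F p) = 0) (w : Fin (n + 1) → ℝ) :
    transversalPart F ξ p w * ν (ξ p) = ν w := by
  have hw := frame_mulVec_frameCoord h w
  rw [frame_mulVec_apply] at hw
  have h1 : hν.mk' ν w = frameCoord F ξ p w (Fin.last n) * ν (ξ p) := by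
    conv_lhs => rw [← hw]
    simp only [map_add, map_sum, map_smul]
    simp [h0]
  exact h1.symm

/-! ### Graphs that are improper affine spheres -/

theorem contDiffOn_of_graphMap {f : (Fin 2 → ℝ) → ℝ} {N : Set (Fin 2 → ℝ)}
    (h : ContDiffOn ℝ ∞ (graphMap f) N) : ContDiffOn ℝ ∞ f N := by
  have := (contDiffOn_pi.1 h) 2
  exact this

theorem hasPD_graphMap {f : (Fin 2 → ℝ) → ℝ} {q : Fin 2 → ℝ} (hf : DifferentiableAt ℝ f q)
    (i : Fin 2) :
    HasPD i (graphMap f) ![if 0 = i then 1 else 0, if 1 = i then 1 else 0, pd i f q] q := by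
  refine HasPD.pi fun a => ?_
  fin_cases a
  · exact HasPD.coord i 0
  · exact HasPD.coord i 1
  · exact HasPD.of_differentiableAt hf i

/-- The affine metric of a graph with constant affine normal is the Hessian. -/
theorem metric_graphMap {f : (Fin 2 → ℝ) → ℝ} {N : Set (Fin 2 → ℝ)} (hN : IsOpen N)
    (hf : ContDiffOn ℝ ∞ f N) {q : Fin 2 → ℝ} (hq : q ∈ N)
    (hdet : (frame (graphMap f) (fun _ => ![0, 0, 1]) q).det ≠ 0) (i j : Fin 2) :
    metric (graphMap f) (fun _ => ![0, 0, 1]) q i j = pd i (pd j f) q := by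
  have h1 : ∀ x ∈ N, ∀ i, HasPD i (graphMap f)
      ![if 0 = i then 1 else 0, if 1 = i then 1 else 0, pd i f x] x :=
    fun x hx i => hasPD_graphMap (differentiableAt_of_contDiffOn hf hN hx) i
  have h2 : HasPD i (pd j (graphMap f)) ![0, 0, pd i (pd j f) q] q := by
    refine HasPD.congr_on (U := N) (G := fun x =>
      ![if 0 = j then 1 else 0, if 1 = j then 1 else 0, pd j f x]) ?_ hN hq
      fun x hx => (h1 x hx j).2
    refine HasPD.pi fun a => ?_
    fin_cases a
    · exact HasPD.const _
    · exact HasPD.const _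
    · exact HasPD.of_differentiableAt
        (differentiableAt_of_contDiffOn (contDiffOn_pd hf hN j) hN hq) i
  -- The conormal of the graph, normalized to be 1 on `(0,0,1)`.
  have hν : IsLinearMap ℝ (fun w : Fin 3 → ℝ => w 2 - pd 0 f q * w 0 - pd 1 f q * w 1) :=
    ⟨fun x y => by simp; ring, fun c x => by simp; ring⟩
  have h3 := transversalPart_mul hdet hν (fun k => by
    rw [(h1 q hq k).2]; fin_cases k <;> simp) (pd i (pd j (graphMap f)) q)
  rw [h2.2] at h3
  simp at h3
  rw [metric, Matrix.of_apply, h2.2, h3]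

/-- The Hessian determinant of a graph that is an improper affine sphere is `±1`. -/
theorem hessian_det_sq {f : (Fin 2 → ℝ) → ℝ} {N : Set (Fin 2 → ℝ)} (hN : IsOpen N)
    (h : IsBlaschkeNormal (graphMap f) N (fun _ => ![0, 0, 1])) {q : Fin 2 → ℝ} (hq : q ∈ N) :
    (pd 0 (pd 0 f) q * pd 1 (pd 1 f) q - pd 0 (pd 1 f) q ^ 2) ^ 2 = 1 := by
  have hf := contDiffOn_of_graphMap h.smooth_immersion
  have h1 := fun i => (hasPD_graphMap (differentiableAt_of_contDiffOn hf hN hq) i).2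
  have hfr : (frame (graphMap f) (fun _ => ![0, 0, 1]) q).det = 1 := by
    rw [Matrix.det_fin_three]
    simp [frame, Fin.snoc, h1]
  have hm := metric_graphMap hN hf hq (h.transversal q hq)
  have hv := h.volume_eq q hq
  rw [hfr, Matrix.det_fin_two, hm, hm, hm, hm, pd_comm hf hN hq 1 0, abs_one, eq_comm,
    Real.sqrt_eq_one] at hv
  rw [← sq_abs, pow_two (pd 0 (pd 1 f) q), hv, one_pow]

/-- The cubic form of an improper affine sphere is apolar to its metric. -/
theorem hessian_apolar {f : (Fin 2 → ℝ) → ℝ} {N : Set (Fin 2 → ℝ)} (hN : IsOpen N)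
    (hf : ContDiffOn ℝ ∞ f N)
    (hdet : ∀ q ∈ N, (pd 0 (pd 0 f) q * pd 1 (pd 1 f) q - pd 0 (pd 1 f) q ^ 2) ^ 2 = 1)
    {q : Fin 2 → ℝ} (hq : q ∈ N) (k : Fin 2) :
    pd k (pd 0 (pd 0 f)) q * pd 1 (pd 1 f) q + pd 0 (pd 0 f) q * pd k (pd 1 (pd 1 f)) q
      - 2 * pd 0 (pd 1 f) q * pd k (pd 0 (pd 1 f)) q = 0 := by
  have h2 : ∀ i j, HasPD k (pd i (pd j f)) (pd k (pd i (pd j f)) q) q := fun i j =>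
    HasPD.of_differentiableAt (differentiableAt_of_contDiffOn
      (contDiffOn_pd (contDiffOn_pd hf hN j) hN i) hN hq) k
  -- Only the square of the Hessian determinant is known to be 1, so the square is differentiated
  -- and the nonzero determinant cancelled afterwards.
  have h3 := ((h2 0 0).mul (h2 1 1)).sub ((h2 0 1).mul (h2 0 1))
  have h4 := (h3.mul h3).2
  have h5 : HasPD k (fun x => (pd 0 (pd 0 f) x * pd 1 (pd 1 f) x - pd 0 (pd 1 f) x * pd 0 (pd 1 f) x)
      * (pd 0 (pd 0 f) x * pd 1 (pd 1 f) x - pd 0 (pd 1 f) x * pd 0 (pd 1 f) x)) 0 q :=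
    (HasPD.const (1 : ℝ)).congr_on hN hq fun x hx => by rw [← hdet x hx]; ring
  rw [h5.2] at h4
  have h6 := hdet q hq
  have h7 : pd 0 (pd 0 f) q * pd 1 (pd 1 f) q - pd 0 (pd 1 f) q ^ 2 ≠ 0 := by
    intro h; rw [h] at h6; norm_num at h6
  refine mul_left_cancel₀ h7 ?_
  linear_combination -h4 / 2

/-! ### Derivatives of warped maps -/

theorem isOpen_productDomain {I : Set ℝ} {N : Set (Fin 2 → ℝ)} (hI : IsOpen I) (hN : IsOpen N) :
    IsOpen (productDomain I N) := by
  have h1 : Continuous fun p : Fin 3 → ℝ => p 0 := continuous_apply 0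
  have h2 : Continuous fun p : Fin 3 → ℝ => (![p 1, p 2] : Fin 2 → ℝ) :=
    continuous_iff_continuousAt.2 fun q => (hasFDerivAt_tail q).continuousAt
  exact (hI.preimage h1).inter (hN.preimage h2)

/-- The warped map is linear in its curve, so `∂/∂t` just differentiates the curve. A general `δ` is
allowed in order to cover `γ`, `γ'` and the curve of the affine normal. -/
theorem hasPD_warpedMap_zero {f : (Fin 2 → ℝ) → ℝ} {δ : ℝ → (Fin 2 → ℝ)} {q : Fin 3 → ℝ}
    (hf : DifferentiableAt ℝ f ![q 1, q 2]) (hδ : DifferentiableAt ℝ δ (q 0)) :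
    HasPD 0 (warpedMap f δ) (warpedMap f (deriv δ) q) q := by
  have hd := fun a => (HasPD.comp_coord (i := (0 : Fin 3)) 0 hδ.hasDerivAt).apply a
  have hk := HasPD.comp_tail hf 0
  refine HasPD.pi fun a => ?_
  fin_cases a
  · exact HasPD.congr_value ((hd 0).mul (HasPD.coord 0 1)) (by simp [warpedMap])
  · exact HasPD.congr_value ((hd 0).mul (HasPD.coord 0 2)) (by simp [warpedMap])
  · exact HasPD.congr_value (((hd 0).mul hk).add (hd 1)) (by simp [warpedMap])
  · exact HasPD.congr_value (hd 0) (by simp [warpedMap])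

theorem hasPD_warpedMap_one {f : (Fin 2 → ℝ) → ℝ} {δ : ℝ → (Fin 2 → ℝ)} {q : Fin 3 → ℝ}
    (hf : DifferentiableAt ℝ f ![q 1, q 2]) (hδ : DifferentiableAt ℝ δ (q 0)) :
    HasPD 1 (warpedMap f δ) ![δ (q 0) 0, 0, δ (q 0) 0 * pd 0 f ![q 1, q 2], 0] q := by
  have hd := fun a => (HasPD.comp_coord (i := (1 : Fin 3)) 0 hδ.hasDerivAt).apply a
  have hk := HasPD.comp_tail hf 1
  refine HasPD.pi fun a => ?_
  fin_cases a
  · exact HasPD.congr_value ((hd 0).mul (HasPD.coord 1 1)) (by simp)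
  · exact HasPD.congr_value ((hd 0).mul (HasPD.coord 1 2)) (by simp)
  · exact HasPD.congr_value (((hd 0).mul hk).add (hd 1)) (by simp)
  · exact HasPD.congr_value (hd 0) (by simp)

theorem hasPD_warpedMap_two {f : (Fin 2 → ℝ) → ℝ} {δ : ℝ → (Fin 2 → ℝ)} {q : Fin 3 → ℝ}
    (hf : DifferentiableAt ℝ f ![q 1, q 2]) (hδ : DifferentiableAt ℝ δ (q 0)) :
    HasPD 2 (warpedMap f δ) ![0, δ (q 0) 0, δ (q 0) 0 * pd 1 f ![q 1, q 2], 0] q := by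
  have hd := fun a => (HasPD.comp_coord (i := (2 : Fin 3)) 0 hδ.hasDerivAt).apply a
  have hk := HasPD.comp_tail hf 2
  refine HasPD.pi fun a => ?_
  fin_cases a
  · exact HasPD.congr_value ((hd 0).mul (HasPD.coord 2 1)) (by simp)
  · exact HasPD.congr_value ((hd 0).mul (HasPD.coord 2 2)) (by simp)
  · exact HasPD.congr_value (((hd 0).mul hk).add (hd 1)) (by simp)
  · exact HasPD.congr_value (hd 0) (by simp)

/-- Partial derivatives of the tangent fields `∂₁F` and `∂₂F` of a warped map. -/
theorem hasPD_warped_tangent {k : (Fin 2 → ℝ) → ℝ} {δ : ℝ → (Fin 2 → ℝ)} {q : Fin 3 → ℝ}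
    (x y : ℝ) (hk : DifferentiableAt ℝ k ![q 1, q 2]) (hδ : DifferentiableAt ℝ δ (q 0))
    (i : Fin 3) :
    HasPD i (fun p => ![δ (p 0) 0 * x, δ (p 0) 0 * y, δ (p 0) 0 * k ![p 1, p 2], 0])
      ((![![deriv δ (q 0) 0 * x, deriv δ (q 0) 0 * y, deriv δ (q 0) 0 * k ![q 1, q 2], 0],
        ![0, 0, δ (q 0) 0 * pd 0 k ![q 1, q 2], 0],
        ![0, 0, δ (q 0) 0 * pd 1 k ![q 1, q 2], 0]] : Fin 3 → (Fin 4 → ℝ)) i) q := by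
  have hd := (HasPD.comp_coord (i := i) 0 hδ.hasDerivAt).apply 0
  have hk := HasPD.comp_tail hk i
  refine HasPD.pi fun a => ?_
  fin_cases a
  · exact HasPD.congr_value (hd.mul (HasPD.const x)) (by fin_cases i <;> simp)
  · exact HasPD.congr_value (hd.mul (HasPD.const y)) (by fin_cases i <;> simp)
  · exact HasPD.congr_value (hd.mul hk) (by fin_cases i <;> simp)
  · exact HasPD.congr_value (HasPD.const (n := 3) (i := i) (q := q) (0 : ℝ)) (by fin_cases i <;> simp)


/-! ### The affine normal of a warped hypersurface -/

/-- The linear form on `ℝ⁴` that vanishes on the tangent space of the warped hypersurface at `q`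
and takes the value `1` on `(0, 0, 1, 0)`. -/
noncomputable def conormal (f : (Fin 2 → ℝ) → ℝ) (γ : ℝ → (Fin 2 → ℝ)) (q : Fin 3 → ℝ)
    (w : Fin 4 → ℝ) : ℝ :=
  w 2 - pd 0 f ![q 1, q 2] * (w 0 - q 1 * w 3) - pd 1 f ![q 1, q 2] * (w 1 - q 2 * w 3)
    - (f ![q 1, q 2] + deriv γ (q 0) 1 / deriv γ (q 0) 0) * w 3

theorem isLinearMap_conormal (f : (Fin 2 → ℝ) → ℝ) (γ : ℝ → (Fin 2 → ℝ)) (q : Fin 3 → ℝ) :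
    IsLinearMap ℝ (conormal f γ q) :=
  ⟨fun x y => by simp [conormal]; ring, fun c x => by simp [conormal]; ring⟩

theorem conormal_warpedMap (f : (Fin 2 → ℝ) → ℝ) (γ δ : ℝ → (Fin 2 → ℝ)) (q : Fin 3 → ℝ) :
    conormal f γ q (warpedMap f δ q)
      = δ (q 0) 1 - deriv γ (q 0) 1 / deriv γ (q 0) 0 * δ (q 0) 0 := by
  simp only [conormal, warpedMap, Matrix.cons_val]
  ring

/-- The quantity `γ₂'' - (γ₂' / γ₁') γ₁''`. -/
noncomputable def bending (γ : ℝ → (Fin 2 → ℝ)) (t : ℝ) : ℝ :=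
  deriv (deriv γ) t 1 - deriv γ t 1 / deriv γ t 0 * deriv (deriv γ) t 0

/-- A positive definite hypersurface `F(t, u, v) = (γ₁ u, γ₁ v, γ₁ f + γ₂, γ₁)`, where the Hessian
determinant of `f` is `±1`. -/
structure IsWarped (f : (Fin 2 → ℝ) → ℝ) (N : Set (Fin 2 → ℝ)) (γ : ℝ → (Fin 2 → ℝ)) (I : Set ℝ)
    (ξ : (Fin 3 → ℝ) → (Fin 4 → ℝ)) : Prop where
  isOpen_base : IsOpen N
  isOpen_interval : IsOpen I
  smooth_fun : ContDiffOn ℝ ∞ f N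
  smooth_curve : ContDiffOn ℝ ∞ γ I
  hessian : ∀ q ∈ N, (pd 0 (pd 0 f) q * pd 1 (pd 1 f) q - pd 0 (pd 1 f) q ^ 2) ^ 2 = 1
  posDef : IsPositiveDefinite (warpedMap f γ) (productDomain I N) ξ

/-! ### Tangent fields, affine metric and volume condition -/

namespace IsWarped

variable {f : (Fin 2 → ℝ) → ℝ} {N : Set (Fin 2 → ℝ)} {γ : ℝ → (Fin 2 → ℝ)} {I : Set ℝ}
  {ξ : (Fin 3 → ℝ) → (Fin 4 → ℝ)} {q : Fin 3 → ℝ}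

theorem isOpen (h : IsWarped f N γ I ξ) : IsOpen (productDomain I N) :=
  isOpen_productDomain h.isOpen_interval h.isOpen_base

theorem diff_f (h : IsWarped f N γ I ξ) (hq : q ∈ productDomain I N) :
    DifferentiableAt ℝ f ![q 1, q 2] :=
  differentiableAt_of_contDiffOn h.smooth_fun h.isOpen_base hq.2

theorem diff_pd (h : IsWarped f N γ I ξ) (hq : q ∈ productDomain I N) (i : Fin 2) :
    DifferentiableAt ℝ (pd i f) ![q 1, q 2] :=
  differentiableAt_of_contDiffOn (contDiffOn_pd h.smooth_fun h.isOpen_base i) h.isOpen_base hq.2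

theorem diff_pd_pd (h : IsWarped f N γ I ξ) (hq : q ∈ productDomain I N) (i j : Fin 2) :
    DifferentiableAt ℝ (pd i (pd j f)) ![q 1, q 2] :=
  differentiableAt_of_contDiffOn (contDiffOn_pd (contDiffOn_pd h.smooth_fun h.isOpen_base j)
    h.isOpen_base i) h.isOpen_base hq.2

theorem diff_curve (h : IsWarped f N γ I ξ) {t : ℝ} (ht : t ∈ I) : DifferentiableAt ℝ γ t :=
  differentiableAt_of_contDiffOn h.smooth_curve h.isOpen_interval ht

theorem diff_deriv (h : IsWarped f N γ I ξ) {t : ℝ} (ht : t ∈ I) :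
    DifferentiableAt ℝ (deriv γ) t :=
  differentiableAt_of_contDiffOn (contDiffOn_deriv h.smooth_curve h.isOpen_interval)
    h.isOpen_interval ht

theorem diff_deriv_deriv (h : IsWarped f N γ I ξ) {t : ℝ} (ht : t ∈ I) :
    DifferentiableAt ℝ (deriv (deriv γ)) t :=
  differentiableAt_of_contDiffOn (contDiffOn_deriv (contDiffOn_deriv h.smooth_curve
    h.isOpen_interval) h.isOpen_interval) h.isOpen_interval ht

theorem diff_normal (h : IsWarped f N γ I ξ) (hq : q ∈ productDomain I N) :
    DifferentiableAt ℝ ξ q :=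
  differentiableAt_of_contDiffOn h.posDef.1.smooth_normal h.isOpen hq

theorem pd_eq (h : IsWarped f N γ I ξ) (hq : q ∈ productDomain I N) (i : Fin 3) :
    pd i (warpedMap f γ) q = (![warpedMap f (deriv γ) q,
      ![γ (q 0) 0, 0, γ (q 0) 0 * pd 0 f ![q 1, q 2], 0],
      ![0, γ (q 0) 0, γ (q 0) 0 * pd 1 f ![q 1, q 2], 0]] : Fin 3 → (Fin 4 → ℝ)) i := by
  fin_cases i
  · exact (hasPD_warpedMap_zero (h.diff_f hq) (h.diff_curve hq.1)).2
  · exact (hasPD_warpedMap_one (h.diff_f hq) (h.diff_curve hq.1)).2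
  · exact (hasPD_warpedMap_two (h.diff_f hq) (h.diff_curve hq.1)).2

theorem hessian_symm (h : IsWarped f N γ I ξ) (hq : q ∈ productDomain I N) :
    pd 1 (pd 0 f) ![q 1, q 2] = pd 0 (pd 1 f) ![q 1, q 2] :=
  pd_comm h.smooth_fun h.isOpen_base hq.2 1 0

theorem pd_pd_zero_eq (h : IsWarped f N γ I ξ) (hq : q ∈ productDomain I N) (i : Fin 3) :
    pd i (pd 0 (warpedMap f γ)) q = (![warpedMap f (deriv (deriv γ)) q,
      ![deriv γ (q 0) 0, 0, deriv γ (q 0) 0 * pd 0 f ![q 1, q 2], 0],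
      ![0, deriv γ (q 0) 0, deriv γ (q 0) 0 * pd 1 f ![q 1, q 2], 0]]
        : Fin 3 → (Fin 4 → ℝ)) i := by
  have e : ∀ x ∈ productDomain I N, pd 0 (warpedMap f γ) x = warpedMap f (deriv γ) x :=
    fun x hx => h.pd_eq hx 0
  fin_cases i
  · exact ((hasPD_warpedMap_zero (h.diff_f hq) (h.diff_deriv hq.1)).congr_on h.isOpen hq e).2
  · exact ((hasPD_warpedMap_one (h.diff_f hq) (h.diff_deriv hq.1)).congr_on h.isOpen hq e).2
  · exact ((hasPD_warpedMap_two (h.diff_f hq) (h.diff_deriv hq.1)).congr_on h.isOpen hq e).2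

theorem pd_pd_one_eq (h : IsWarped f N γ I ξ) (hq : q ∈ productDomain I N) (i : Fin 3) :
    pd i (pd 1 (warpedMap f γ)) q = (![
      ![deriv γ (q 0) 0, 0, deriv γ (q 0) 0 * pd 0 f ![q 1, q 2], 0],
      ![0, 0, γ (q 0) 0 * pd 0 (pd 0 f) ![q 1, q 2], 0],
      ![0, 0, γ (q 0) 0 * pd 0 (pd 1 f) ![q 1, q 2], 0]] : Fin 3 → (Fin 4 → ℝ)) i := by
  refine ((hasPD_warped_tangent 1 0 (h.diff_pd hq 0) (h.diff_curve hq.1) i).congr_on h.isOpen hq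
    (fun x hx => by rw [h.pd_eq hx]; simp)).2.trans ?_
  simp [h.hessian_symm hq]

theorem pd_pd_two_eq (h : IsWarped f N γ I ξ) (hq : q ∈ productDomain I N) (i : Fin 3) :
    pd i (pd 2 (warpedMap f γ)) q = (![
      ![0, deriv γ (q 0) 0, deriv γ (q 0) 0 * pd 1 f ![q 1, q 2], 0],
      ![0, 0, γ (q 0) 0 * pd 0 (pd 1 f) ![q 1, q 2], 0],
      ![0, 0, γ (q 0) 0 * pd 1 (pd 1 f) ![q 1, q 2], 0]] : Fin 3 → (Fin 4 → ℝ)) i := by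
  refine ((hasPD_warped_tangent 0 1 (h.diff_pd hq 1) (h.diff_curve hq.1) i).congr_on h.isOpen hq
    (fun x hx => by rw [h.pd_eq hx]; simp)).2.trans ?_
  simp

theorem det_ne_zero (h : IsWarped f N γ I ξ) (hq : q ∈ productDomain I N) :
    (frame (warpedMap f γ) ξ q).det ≠ 0 :=
  h.posDef.1.transversal q hq

/-- No division by `γ₁'` occurs, because this formula is what proves `γ₁` and `γ₁'` nonzero. -/
theorem det_frame (h : IsWarped f N γ I ξ) (hq : q ∈ productDomain I N) :
    (frame (warpedMap f γ) ξ q).det = -γ (q 0) 0 ^ 2 *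
      (deriv γ (q 0) 0 * (ξ q 2 - pd 0 f ![q 1, q 2] * (ξ q 0 - q 1 * ξ q 3)
        - pd 1 f ![q 1, q 2] * (ξ q 1 - q 2 * ξ q 3) - f ![q 1, q 2] * ξ q 3)
        - deriv γ (q 0) 1 * ξ q 3) := by
  have e : frame (warpedMap f γ) ξ q =
      !![deriv γ (q 0) 0 * q 1, γ (q 0) 0, 0, ξ q 0;
        deriv γ (q 0) 0 * q 2, 0, γ (q 0) 0, ξ q 1;
        deriv γ (q 0) 0 * f ![q 1, q 2] + deriv γ (q 0) 1, γ (q 0) 0 * pd 0 f ![q 1, q 2],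
          γ (q 0) 0 * pd 1 f ![q 1, q 2], ξ q 2;
        deriv γ (q 0) 0, 0, 0, ξ q 3] := by
    ext i j
    fin_cases i <;> fin_cases j <;> simp [frame, Fin.snoc, h.pd_eq hq, warpedMap] <;> rfl
  rw [e]
  simp [Matrix.det_succ_row_zero, Fin.sum_univ_succ, Fin.succAbove]
  ring

theorem curve_ne_zero (h : IsWarped f N γ I ξ) (hq : q ∈ productDomain I N) :
    γ (q 0) 0 ≠ 0 := by
  intro h0
  apply h.det_ne_zero hq
  rw [h.det_frame hq, h0]
  ring

/-- Where `γ₁' = 0`, the hypersurface would contain a curve with tangential acceleration in the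
direction `∂₁`, against the definiteness of the metric. -/
theorem deriv_ne_zero (h : IsWarped f N γ I ξ) (hq : q ∈ productDomain I N) :
    deriv γ (q 0) 0 ≠ 0 := by
  intro h0
  -- If `γ₁' = 0`, the last coordinate vanishes on all tangent vectors and on `∂₁∂₁F`. Since `h₁₁ >
  -- 0`, it vanishes on `ξ` too, and the frame degenerates.
  have hν : IsLinearMap ℝ (fun w : Fin 4 → ℝ => w 3) := ⟨fun _ _ => rfl, fun _ _ => rfl⟩
  have h1 := transversalPart_mul (h.det_ne_zero hq) hν
    (fun i => by rw [h.pd_eq hq]; fin_cases i <;> simp [warpedMap, h0])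
    (pd 1 (pd 1 (warpedMap f γ)) q)
  have h2 : 0 < metric (warpedMap f γ) ξ q 1 1 := (h.posDef.2 q hq).diag_pos
  rw [metric, Matrix.of_apply] at h2
  have h3 : ξ q 3 = 0 := by
    refine (mul_eq_zero.1 (h1.trans ?_)).resolve_left h2.ne'
    rw [h.pd_pd_one_eq hq]
    simp
  apply h.det_ne_zero hq
  rw [h.det_frame hq, h0, h3]
  ring

theorem det_frame_eq_conormal (h : IsWarped f N γ I ξ) (hq : q ∈ productDomain I N) :
    (frame (warpedMap f γ) ξ q).det
      = -γ (q 0) 0 ^ 2 * deriv γ (q 0) 0 * conormal f γ q (ξ q) := by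
  have := h.deriv_ne_zero hq
  rw [h.det_frame hq, conormal]
  field_simp
  ring

theorem conormal_ne_zero (h : IsWarped f N γ I ξ) (hq : q ∈ productDomain I N) :
    conormal f γ q (ξ q) ≠ 0 := by
  intro h0
  apply h.det_ne_zero hq
  rw [h.det_frame_eq_conormal hq, h0, mul_zero]

theorem transversalPart_eq (h : IsWarped f N γ I ξ) (hq : q ∈ productDomain I N)
    (w : Fin 4 → ℝ) :
    transversalPart (warpedMap f γ) ξ q w = conormal f γ q w / conormal f γ q (ξ q) := by
  rw [eq_div_iff (h.conormal_ne_zero hq)]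
  refine transversalPart_mul (h.det_ne_zero hq) (isLinearMap_conormal f γ q) (fun i => ?_) w
  rw [h.pd_eq hq]
  have := h.deriv_ne_zero hq
  fin_cases i
  · simp only [Fin.zero_eta, Matrix.cons_val_zero, conormal_warpedMap]
    field_simp
    ring
  · simp [conormal]; ring
  · simp [conormal]; ring

/-- The mixed entries vanish because `∂ₜ∂ᵤF` and `∂ₜ∂ᵥF` are multiples of `∂ᵤF` and `∂ᵥF`; second
derivatives within the plane are vertical and carry the Hessian of `f`. -/
theorem metric_eq (h : IsWarped f N γ I ξ) (hq : q ∈ productDomain I N) :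
    metric (warpedMap f γ) ξ q = !![bending γ (q 0) / conormal f γ q (ξ q), 0, 0;
      0, γ (q 0) 0 / conormal f γ q (ξ q) * pd 0 (pd 0 f) ![q 1, q 2],
        γ (q 0) 0 / conormal f γ q (ξ q) * pd 0 (pd 1 f) ![q 1, q 2];
      0, γ (q 0) 0 / conormal f γ q (ξ q) * pd 0 (pd 1 f) ![q 1, q 2],
        γ (q 0) 0 / conormal f γ q (ξ q) * pd 1 (pd 1 f) ![q 1, q 2]] := by
  ext i j
  rw [metric, Matrix.of_apply, h.transversalPart_eq hq]
  generalize hφ : conormal f γ q (ξ q) = φ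
  fin_cases j
  · simp only [Fin.zero_eta, h.pd_pd_zero_eq hq]
    fin_cases i
    · simp [conormal_warpedMap, bending]
    · simp [conormal]; left; ring
    · simp [conormal]; left; ring
  · simp only [Fin.mk_one, h.pd_pd_one_eq hq]
    fin_cases i
    · simp [conormal]; left; ring
    · simp [conormal]; ring
    · simp [conormal]; ring
  · simp only [Fin.reduceFinMk, h.pd_pd_two_eq hq]
    fin_cases i
    · simp [conormal]; left; ring
    · simp [conormal]; ring
    · simp [conormal]; ring

theorem bending_div_pos (h : IsWarped f N γ I ξ) (hq : q ∈ productDomain I N) :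
    0 < bending γ (q 0) / conormal f γ q (ξ q) := by
  have := (h.posDef.2 q hq).diag_pos (i := 0)
  rw [h.metric_eq hq] at this
  simpa using this

theorem bending_ne_zero (h : IsWarped f N γ I ξ) (hq : q ∈ productDomain I N) :
    bending γ (q 0) ≠ 0 := by
  intro h0
  have := h.bending_div_pos hq
  simp [h0] at this

/-- The volume condition determines the transversal component of the affine normal. -/
theorem conormal_pow_five (h : IsWarped f N γ I ξ) (hq : q ∈ productDomain I N) :
    conormal f γ q (ξ q) ^ 5 * (γ (q 0) 0 ^ 2 * deriv γ (q 0) 0 ^ 2) = bending γ (q 0) := by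
  have hv := congrArg (· ^ 2) (h.posDef.1.volume_eq q hq)
  have hb := h.bending_div_pos hq
  have hφ := h.conormal_ne_zero hq
  have hγ := h.curve_ne_zero hq
  have hH := h.hessian _ hq.2
  have hpos := (h.posDef.2 q hq).det_pos
  simp only [sq_abs, Real.sq_sqrt (abs_nonneg _)] at hv
  rw [abs_of_pos hpos, h.det_frame_eq_conormal hq] at hv
  rw [h.metric_eq hq, Matrix.det_fin_three] at hpos hv
  simp only [Matrix.of_apply, Matrix.cons_val', Matrix.cons_val] at hpos hv
  generalize conormal f γ q (ξ q) = φ at *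
  generalize bending γ (q 0) = b at *
  generalize γ (q 0) 0 = g at *
  generalize deriv γ (q 0) 0 = g' at *
  generalize pd 0 (pd 0 f) ![q 1, q 2] = x at *
  generalize pd 0 (pd 1 f) ![q 1, q 2] = y at *
  generalize pd 1 (pd 1 f) ![q 1, q 2] = z at *
  -- Positivity of `det h` excludes the Hessian determinant `-1`.
  have h1 : 0 < x * z - y ^ 2 := by
    have e : 0 < (b / φ * (g / φ) ^ 2) * (x * z - y ^ 2) := by linarith
    refine pos_of_mul_pos_right e ?_
    positivity
  have h2 : x * z - y ^ 2 = 1 := by nlinarith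
  have h3 : (g ^ 2 * g' * φ) ^ 2 = b / φ * (g / φ) ^ 2 := by
    linear_combination hv + b / φ * (g / φ) ^ 2 * h2
  field_simp at h3
  linear_combination h3

/-- In the volume condition everything but `φ` depends on `t` alone, and the odd fifth power is
injective, so not even a sign is left free. -/
theorem conormal_eq_of_eq (h : IsWarped f N γ I ξ) {q' : Fin 3 → ℝ} (hq : q ∈ productDomain I N)
    (hq' : q' ∈ productDomain I N) (h0 : q 0 = q' 0) :
    conormal f γ q (ξ q) = conormal f γ q' (ξ q') := by
  have h1 := h.conormal_pow_five hq
  have h2 := h.conormal_pow_five hq'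
  rw [← h0, ← h1] at h2
  have hne : γ (q 0) 0 ^ 2 * deriv γ (q 0) 0 ^ 2 ≠ 0 :=
    mul_ne_zero (pow_ne_zero 2 (h.curve_ne_zero hq)) (pow_ne_zero 2 (h.deriv_ne_zero hq))
  have h3 := mul_right_cancel₀ hne h2
  exact ((by decide : Odd 5).strictMono_pow.injective h3).symm

end IsWarped

/-- Restriction to a line in the direction of the first coordinate. -/
theorem hasDerivAt_line {E : Type*} [NormedAddCommGroup E] [NormedSpace ℝ E]
    {G : (Fin 3 → ℝ) → E} {t u v : ℝ} (hG : DifferentiableAt ℝ G ![t, u, v]) :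
    HasDerivAt (fun t => G ![t, u, v]) (pd 0 G ![t, u, v]) t := by
  have h1 : HasDerivAt (fun t : ℝ => (![t, u, v] : Fin 3 → ℝ)) (Pi.single 0 1) t := by
    rw [hasDerivAt_pi]
    intro a
    fin_cases a
    · exact hasDerivAt_id t
    · exact hasDerivAt_const t u
    · exact hasDerivAt_const t v
  exact hG.hasFDerivAt.comp_hasDerivAt t h1

/-! ### The affine normal as a warped map -/

namespace IsWarped

variable {f : (Fin 2 → ℝ) → ℝ} {N : Set (Fin 2 → ℝ)} {γ : ℝ → (Fin 2 → ℝ)} {I : Set ℝ}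
  {ξ : (Fin 3 → ℝ) → (Fin 4 → ℝ)} {q : Fin 3 → ℝ}

theorem conormal_pd_normal (h : IsWarped f N γ I ξ) (hq : q ∈ productDomain I N) (i : Fin 3) :
    conormal f γ q (pd i ξ q) = 0 := by
  have h1 := h.posDef.1.equiaffine q hq i
  rw [h.transversalPart_eq hq, div_eq_zero_iff] at h1
  exact h1.resolve_right (h.conormal_ne_zero hq)

theorem hasDerivAt_slope (h : IsWarped f N γ I ξ) (hq : q ∈ productDomain I N) :
    HasDerivAt (fun t => deriv γ t 1 / deriv γ t 0)
      (bending γ (q 0) / deriv γ (q 0) 0) (q 0) := by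
  have h1 := hasDerivAt_pi.1 (h.diff_deriv hq.1).hasDerivAt
  have h2 := h.deriv_ne_zero hq
  have h3 := (h1 1).div (h1 0) h2
  refine h3.congr_deriv ?_
  rw [bending]
  field_simp

/-- Partial derivatives of the transversal component of the affine normal. -/
theorem hasPD_conormal (h : IsWarped f N γ I ξ) (hq : q ∈ productDomain I N) (i : Fin 3) :
    HasPD i (fun x => conormal f γ x (ξ x))
      ((![-(bending γ (q 0) / deriv γ (q 0) 0) * ξ q 3,
        -pd 0 (pd 0 f) ![q 1, q 2] * (ξ q 0 - q 1 * ξ q 3)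
          - pd 0 (pd 1 f) ![q 1, q 2] * (ξ q 1 - q 2 * ξ q 3),
        -pd 0 (pd 1 f) ![q 1, q 2] * (ξ q 0 - q 1 * ξ q 3)
          - pd 1 (pd 1 f) ![q 1, q 2] * (ξ q 1 - q 2 * ξ q 3)] : Fin 3 → ℝ) i) q := by
  have hξ := fun a => (HasPD.of_differentiableAt (h.diff_normal hq) i).apply a
  have h0 := HasPD.comp_tail (h.diff_pd hq 0) i
  have h1 := HasPD.comp_tail (h.diff_pd hq 1) i
  have hf := HasPD.comp_tail (h.diff_f hq) i
  have hρ := HasPD.comp_coord (i := i) 0 (h.hasDerivAt_slope hq)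
  have hs := h.hessian_symm hq
  have hc := h.conormal_pd_normal hq i
  refine HasPD.congr_value ((((hξ 2).sub (h0.mul ((hξ 0).sub ((HasPD.coord i 1).mul (hξ 3))))).sub
    (h1.mul ((hξ 1).sub ((HasPD.coord i 2).mul (hξ 3))))).sub ((hf.add hρ).mul (hξ 3))) ?_
  -- The product-rule terms with derivatives of `ξ` add up to `ν(∂ᵢξ) = 0`; only the derivatives of
  -- the coefficients of `ν` remain.
  rw [conormal] at hc
  fin_cases i
  · simp at hc ⊢
    linear_combination -hc
  · simp at hc ⊢
    linear_combination -hc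
  · simp [hs] at hc ⊢
    linear_combination -hc

theorem mem_slice (hq : q ∈ productDomain I N) {t : ℝ} (ht : t ∈ I) :
    ![t, q 1, q 2] ∈ productDomain I N :=
  ⟨ht, by simpa using hq.2⟩

theorem vec_eta (q : Fin 3 → ℝ) : ![q 0, q 1, q 2] = q := by
  ext i; fin_cases i <;> rfl

/-- The transversal component of the affine normal depends on the first coordinate only. -/
theorem hasDerivAt_conormal (h : IsWarped f N γ I ξ) (hq : q ∈ productDomain I N) {t : ℝ}
    (ht : t ∈ I) :
    HasDerivAt (fun t => conormal f γ ![t, q 1, q 2] (ξ ![t, q 1, q 2]))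
      (-(bending γ t / deriv γ t 0) * ξ ![t, q 1, q 2] 3) t := by
  have h1 := h.hasPD_conormal (mem_slice hq ht) 0
  have h2 := hasDerivAt_line h1.1
  rw [h1.2] at h2
  simpa using h2

/-- As `φ` is constant along the `u, v` slices, the Hessian of `f` annihilates `(ξ₀ - uξ₃, ξ₁ -
vξ₃)`. It is invertible, and Cramer's rule finishes. -/
theorem normal_horizontal (h : IsWarped f N γ I ξ) (hq : q ∈ productDomain I N) :
    ξ q 0 = q 1 * ξ q 3 ∧ ξ q 1 = q 2 * ξ q 3 := by
  have h1 : ∀ x ∈ productDomain I N, conormal f γ x (ξ x)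
      = (fun t => conormal f γ ![t, q 1, q 2] (ξ ![t, q 1, q 2])) (x 0) := fun x hx =>
    h.conormal_eq_of_eq hx (mem_slice hq hx.1) rfl
  have h2 : ∀ i : Fin 3, _ := fun i =>
    (HasPD.comp_coord (i := i) 0 (h.hasDerivAt_conormal hq hq.1)).congr_on h.isOpen hq h1
  have e1 := (h.hasPD_conormal hq 1).2.symm.trans (h2 1).2
  have e2 := (h.hasPD_conormal hq 2).2.symm.trans (h2 2).2
  simp at e1 e2
  have hH := h.hessian _ hq.2
  have hne : pd 0 (pd 0 f) ![q 1, q 2] * pd 1 (pd 1 f) ![q 1, q 2]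
      - pd 0 (pd 1 f) ![q 1, q 2] ^ 2 ≠ 0 := by
    intro h0; rw [h0] at hH; norm_num at hH
  constructor
  · refine sub_eq_zero.1 (mul_left_cancel₀ hne ?_)
    linear_combination -pd 1 (pd 1 f) ![q 1, q 2] * e1 + pd 0 (pd 1 f) ![q 1, q 2] * e2
  · refine sub_eq_zero.1 (mul_left_cancel₀ hne ?_)
    linear_combination pd 0 (pd 1 f) ![q 1, q 2] * e1 - pd 0 (pd 0 f) ![q 1, q 2] * e2

/-- The `t`-derivative of `φ` is a nonzero function of `t` times `ξ₃`, and `φ` itself depends on `t`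
only. -/
theorem normal_three_eq_of_eq (h : IsWarped f N γ I ξ) {q' : Fin 3 → ℝ}
    (hq : q ∈ productDomain I N) (hq' : q' ∈ productDomain I N) (h0 : q 0 = q' 0) :
    ξ q 3 = ξ q' 3 := by
  have h1 := h.hasDerivAt_conormal hq hq.1
  have h2 := h.hasDerivAt_conormal hq' hq'.1
  rw [← h0] at h2
  have h3 := h1.unique (h2.congr_of_eventuallyEq (Filter.eventuallyEq_of_mem
    (h.isOpen_interval.mem_nhds hq.1) fun t ht =>
      h.conormal_eq_of_eq (mem_slice hq ht) (mem_slice hq' ht) rfl))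
  have e : ![q 0, q' 1, q' 2] = q' := by rw [h0, vec_eta]
  rw [vec_eta, e] at h3
  exact mul_left_cancel₀ (neg_ne_zero.2 (div_ne_zero (h.bending_ne_zero hq)
    (h.deriv_ne_zero hq))) h3

/-- The affine normal of a warped hypersurface is itself a warped map over the same `f`. -/
theorem exists_normal_eq (h : IsWarped f N γ I ξ) {p : Fin 3 → ℝ} (hp : p ∈ productDomain I N) :
    ∃ δ : ℝ → (Fin 2 → ℝ), (∀ t ∈ I, DifferentiableAt ℝ δ t) ∧
      ∀ q ∈ productDomain I N, ξ q = warpedMap f δ q := by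
  -- On the `t`-line through `p`, the fourth component of a warped map is `δ₁`, and `φ = δ₂ -
  -- (γ₂'/γ₁') δ₁` is solved for `δ₂`. One line suffices since `φ` and `ξ₃` depend on `t` only.
  refine ⟨fun t => ![ξ ![t, p 1, p 2] 3,
    conormal f γ ![t, p 1, p 2] (ξ ![t, p 1, p 2])
      + deriv γ t 1 / deriv γ t 0 * ξ ![t, p 1, p 2] 3], fun t ht => ?_, fun q hq => ?_⟩
  · have h1 : DifferentiableAt ℝ (fun t => ξ ![t, p 1, p 2] 3) t :=
      differentiableAt_pi.1 (hasDerivAt_line (h.diff_normal (mem_slice hp ht))).differentiableAt 3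
    have h2 := (h.hasDerivAt_conormal hp ht).differentiableAt
    have h3 : DifferentiableAt ℝ (fun t => deriv γ t 1 / deriv γ t 0) t :=
      (h.hasDerivAt_slope (mem_slice hp ht)).differentiableAt
    rw [differentiableAt_pi]
    intro a
    fin_cases a
    · exact h1
    · exact h2.add (h3.mul h1)
  · have hs := mem_slice hp hq.1
    have h1 := h.conormal_eq_of_eq hq hs rfl
    have h2 := h.normal_three_eq_of_eq hq hs rfl
    obtain ⟨h3, h4⟩ := h.normal_horizontal hq
    simp only [warpedMap, Matrix.cons_val, ← h1, ← h2]
    ext a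
    fin_cases a
    · simpa [mul_comm] using h3
    · simpa [mul_comm] using h4
    · simp [conormal, h3, h4]; ring
    · simp

/-! ### The geometric tensors at a point and their symmetry -/

/-- A warped hypersurface over an improper affine sphere is pointwise `Z₃`-symmetric. -/
theorem admitsPointwiseSymmetry_Z3 (h : IsWarped f N γ I ξ) :
    AdmitsPointwiseSymmetry (warpedMap f γ) (productDomain I N) ξ Z3 := by
  intro p hp
  obtain ⟨δ, hδ, hξ⟩ := h.exists_normal_eq hp
  have hdet := h.det_ne_zero hp
  have hφ : ∀ q ∈ productDomain I N, conormal f γ q (ξ q)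
      = δ (q 0) 1 - deriv γ (q 0) 1 / deriv γ (q 0) 0 * δ (q 0) 0 := fun q hq => by
    rw [hξ q hq, conormal_warpedMap]
  have hφ0 := h.conormal_ne_zero hp
  rw [hφ p hp] at hφ0
  have hγ0 := h.curve_ne_zero hp
  have hγ1 := h.deriv_ne_zero hp
  set Φ : ℝ → ℝ := fun t => δ t 1 - deriv γ t 1 / deriv γ t 0 * δ t 0 with hΦ
  have hΦp : δ (p 0) 1 - deriv γ (p 0) 1 / deriv γ (p 0) 0 * δ (p 0) 0 = Φ (p 0) := rfl
  rw [hΦp] at hφ0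
  have hmetric : ∀ q ∈ productDomain I N, metric (warpedMap f γ) ξ q =
      !![bending γ (q 0) / Φ (q 0), 0, 0;
        0, γ (q 0) 0 / Φ (q 0) * pd 0 (pd 0 f) ![q 1, q 2],
          γ (q 0) 0 / Φ (q 0) * pd 0 (pd 1 f) ![q 1, q 2];
        0, γ (q 0) 0 / Φ (q 0) * pd 0 (pd 1 f) ![q 1, q 2],
          γ (q 0) 0 / Φ (q 0) * pd 1 (pd 1 f) ![q 1, q 2]] := fun q hq => by
    rw [h.metric_eq hq, hφ q hq]
  have dγ := differentiableAt_pi.1 (h.diff_curve hp.1)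
  have dγ2 := differentiableAt_pi.1 (h.diff_deriv_deriv hp.1)
  have dδ := differentiableAt_pi.1 (hδ _ hp.1)
  have dρ : DifferentiableAt ℝ (fun t => deriv γ t 1 / deriv γ t 0) (p 0) :=
    (h.hasDerivAt_slope hp).differentiableAt
  have dΦ : DifferentiableAt ℝ Φ (p 0) := (dδ 1).sub (dρ.mul (dδ 0))
  have db : DifferentiableAt ℝ (bending γ) (p 0) := (dγ2 1).sub (dρ.mul (dγ2 0))
  have hA := (db.fun_div dΦ hφ0).hasDerivAt
  have hB := ((dγ 0).fun_div dΦ hφ0).hasDerivAt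
  -- The values of these derivatives are irrelevant: they enter only the coefficients of the
  -- rotation-invariant terms of `K`.
  generalize deriv (fun t => bending γ t / Φ t) (p 0) = A' at hA
  generalize deriv (fun t => γ t 0 / Φ t) (p 0) = B' at hB
  have hpdA : ∀ k : Fin 3, HasPD k (fun q => bending γ (q 0) / Φ (q 0)) _ p := fun k =>
    HasPD.comp_coord (i := k) 0 hA
  have hpdB : ∀ (k : Fin 3) (i j : Fin 2),
      HasPD k (fun q => γ (q 0) 0 / Φ (q 0) * pd i (pd j f) ![q 1, q 2]) _ p := fun k i j =>
    (HasPD.comp_coord (i := k) 0 hB).mul (HasPD.comp_tail (h.diff_pd_pd hp i j) k)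
  -- Symmetry of the third derivatives reduces the cubic to four coefficients.
  have t1 : pd 1 (pd 0 (pd 0 f)) ![p 1, p 2] = pd 0 (pd 0 (pd 1 f)) ![p 1, p 2] := by
    rw [pd_comm (contDiffOn_pd h.smooth_fun h.isOpen_base 0) h.isOpen_base hp.2 1 0]
    exact ((HasPD.of_differentiableAt (h.diff_pd_pd hp 0 1) 0).congr_on h.isOpen_base hp.2
      fun x hx => pd_comm h.smooth_fun h.isOpen_base hx 1 0).2
  have t2 : pd 1 (pd 0 (pd 1 f)) ![p 1, p 2] = pd 0 (pd 1 (pd 1 f)) ![p 1, p 2] :=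
    pd_comm (contDiffOn_pd h.smooth_fun h.isOpen_base 1) h.isOpen_base hp.2 1 0
  have apolar := fun k => hessian_apolar h.isOpen_base h.smooth_fun h.hessian hp.2 k
  set x := pd 0 (pd 0 f) ![p 1, p 2] with hx
  set y := pd 0 (pd 1 f) ![p 1, p 2] with hy
  set z := pd 1 (pd 1 f) ![p 1, p 2] with hz
  set B := γ (p 0) 0 / Φ (p 0) with hBdef
  set A := bending γ (p 0) / Φ (p 0) with hAdef
  set η := δ (p 0) 0 with hη
  have hpd : ∀ k i j, pd k (fun q => metric (warpedMap f γ) ξ q i j) p =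
      (![!![A', 0, 0; 0, B' * x, B' * y; 0, B' * y, B' * z],
        !![0, 0, 0; 0, B * pd 0 (pd 0 (pd 0 f)) ![p 1, p 2], B * pd 0 (pd 0 (pd 1 f)) ![p 1, p 2];
          0, B * pd 0 (pd 0 (pd 1 f)) ![p 1, p 2], B * pd 0 (pd 1 (pd 1 f)) ![p 1, p 2]],
        !![0, 0, 0; 0, B * pd 0 (pd 0 (pd 1 f)) ![p 1, p 2], B * pd 0 (pd 1 (pd 1 f)) ![p 1, p 2];
          0, B * pd 0 (pd 1 (pd 1 f)) ![p 1, p 2], B * pd 1 (pd 1 (pd 1 f)) ![p 1, p 2]]]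
        : Fin 3 → Matrix (Fin 3) (Fin 3) ℝ) k i j := by
    have hm : ∀ i j, ∀ q ∈ productDomain I N, metric (warpedMap f γ) ξ q i j = _ :=
      fun i j q hq => congrFun (congrFun (hmetric q hq) i) j
    have hzero : ∀ k : Fin 3, HasPD k (fun _ : Fin 3 → ℝ => (0 : ℝ)) 0 p := fun k => HasPD.const 0
    intro k i j
    fin_cases i <;> fin_cases j
    · refine ((hpdA k).congr_on h.isOpen hp (hm 0 0)).2.trans ?_
      fin_cases k <;> simp
    · refine ((hzero k).congr_on h.isOpen hp (hm 0 1)).2.trans ?_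
      fin_cases k <;> simp
    · refine ((hzero k).congr_on h.isOpen hp (hm 0 2)).2.trans ?_
      fin_cases k <;> simp
    · refine ((hzero k).congr_on h.isOpen hp (hm 1 0)).2.trans ?_
      fin_cases k <;> simp
    · refine ((hpdB k 0 0).congr_on h.isOpen hp (hm 1 1)).2.trans ?_
      fin_cases k <;> simp [← hx, t1]
    · refine ((hpdB k 0 1).congr_on h.isOpen hp (hm 1 2)).2.trans ?_
      fin_cases k <;> simp [← hy, t2]
    · refine ((hzero k).congr_on h.isOpen hp (hm 2 0)).2.trans ?_
      fin_cases k <;> simp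
    · refine ((hpdB k 0 1).congr_on h.isOpen hp (hm 2 1)).2.trans ?_
      fin_cases k <;> simp [← hy, t2]
    · refine ((hpdB k 1 1).congr_on h.isOpen hp (hm 2 2)).2.trans ?_
      fin_cases k <;> simp [← hz]
  have hcoord : ∀ (w : Fin 4 → ℝ) (c : Fin 4 → ℝ),
      c 0 • warpedMap f (deriv γ) p
        + c 1 • ![γ (p 0) 0, 0, γ (p 0) 0 * pd 0 f ![p 1, p 2], 0]
        + c 2 • ![0, γ (p 0) 0, γ (p 0) 0 * pd 1 f ![p 1, p 2], 0]
        + c 3 • warpedMap f δ p = w →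
      ∀ k : Fin 3, tangentialPart (warpedMap f γ) ξ p w k = c k.castSucc := by
    intro w c hw k
    rw [tangentialPart, frameCoord_eq hdet (c := c)]
    rw [frame_mulVec_apply, ← hw, Fin.sum_univ_three, h.pd_eq hp, h.pd_eq hp, h.pd_eq hp, hξ p hp]
    rfl
  have hδ1 : δ (p 0) 1 = Φ (p 0) + deriv γ (p 0) 1 / deriv γ (p 0) 0 * η := by
    rw [hΦ]; simp [hη]
  have hb : deriv (deriv γ) (p 0) 1
      = A * Φ (p 0) + deriv γ (p 0) 1 / deriv γ (p 0) 0 * deriv (deriv γ) (p 0) 0 := by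
    rw [hAdef, div_mul_cancel₀ _ hφ0, bending]; ring
  have hBΦ : γ (p 0) 0 = B * Φ (p 0) := by rw [hBdef, div_mul_cancel₀ _ hφ0]
  -- A vertical vector minus its `ξ`-component is a multiple of `∂ₜF`: outside the vertical
  -- coordinate, `ξ` is `η/γ₁'` times `∂ₜF`. So `∇` has no plane-to-plane symbols, and the plane
  -- part of `K` comes from the Levi-Civita connection alone.
  have hvert : ∀ r k : ℝ, r = B * k → ∀ l : Fin 3,
      tangentialPart (warpedMap f γ) ξ p ![0, 0, γ (p 0) 0 * k, 0] l
        = (![-(r * η / deriv γ (p 0) 0), 0, 0] : Fin 3 → ℝ) l := by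
    intro r k hr l
    rw [hcoord _ ![-(r * η / deriv γ (p 0) 0), 0, 0, r]]
    · fin_cases l <;> rfl
    · rw [hr]
      ext a
      fin_cases a <;> simp [warpedMap, ← hη]
      · field_simp; ring
      · field_simp; ring
      · rw [hδ1, hBΦ]; field_simp; ring
      · field_simp; ring
  set α := (deriv (deriv γ) (p 0) 0 - A * η) / deriv γ (p 0) 0 with hα
  set κ := deriv γ (p 0) 0 / γ (p 0) 0 with hκ
  have hΓ : ∀ i j l, inducedChristoffel (warpedMap f γ) ξ p i j l =
      (![!![α, 0, 0; 0, κ, 0; 0, 0, κ],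
        !![0, κ, 0; -(B * x * η / deriv γ (p 0) 0), 0, 0; -(B * y * η / deriv γ (p 0) 0), 0, 0],
        !![0, 0, κ; -(B * y * η / deriv γ (p 0) 0), 0, 0; -(B * z * η / deriv γ (p 0) 0), 0, 0]]
        : Fin 3 → Matrix (Fin 3) (Fin 3) ℝ) i j l := by
    have h01 : ∀ l, tangentialPart (warpedMap f γ) ξ p
        ![deriv γ (p 0) 0, 0, deriv γ (p 0) 0 * pd 0 f ![p 1, p 2], 0] l
          = (![0, κ, 0] : Fin 3 → ℝ) l := by
      intro l
      rw [hcoord _ ![0, κ, 0, 0]]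
      · fin_cases l <;> rfl
      · ext a
        fin_cases a <;> simp [hκ] <;> field_simp
    have h02 : ∀ l, tangentialPart (warpedMap f γ) ξ p
        ![0, deriv γ (p 0) 0, deriv γ (p 0) 0 * pd 1 f ![p 1, p 2], 0] l
          = (![0, 0, κ] : Fin 3 → ℝ) l := by
      intro l
      rw [hcoord _ ![0, 0, κ, 0]]
      · fin_cases l <;> rfl
      · ext a
        fin_cases a <;> simp [hκ] <;> field_simp
    have h00 : ∀ l, tangentialPart (warpedMap f γ) ξ p (warpedMap f (deriv (deriv γ)) p) l
          = (![α, 0, 0] : Fin 3 → ℝ) l := by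
      intro l
      rw [hcoord _ ![α, 0, 0, A]]
      · fin_cases l <;> rfl
      · ext a
        fin_cases a <;> simp [hα, warpedMap, ← hη]
        · field_simp; ring
        · field_simp; ring
        · rw [hδ1, hb]; field_simp; ring
        · field_simp; ring
    intro i j l
    rw [inducedChristoffel]
    fin_cases j
    · simp only [Fin.zero_eta, h.pd_pd_zero_eq hp]
      fin_cases i
      · exact (h00 l).trans (by fin_cases l <;> simp)
      · exact (h01 l).trans (by fin_cases l <;> simp)
      · exact (h02 l).trans (by fin_cases l <;> simp)
    · simp only [Fin.mk_one, h.pd_pd_one_eq hp]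
      fin_cases i
      · exact (h01 l).trans (by fin_cases l <;> simp)
      · exact (hvert _ _ rfl l).trans (by fin_cases l <;> simp [← hx])
      · exact (hvert _ _ rfl l).trans (by fin_cases l <;> simp [← hy])
    · simp only [Fin.reduceFinMk, h.pd_pd_two_eq hp]
      fin_cases i
      · exact (h02 l).trans (by fin_cases l <;> simp)
      · exact (hvert _ _ rfl l).trans (by fin_cases l <;> simp [← hy])
      · exact (hvert _ _ rfl l).trans (by fin_cases l <;> simp [← hz])
  have hshape : shape (warpedMap f γ) ξ p = !![-(deriv δ (p 0) 0 / deriv γ (p 0) 0), 0, 0;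
      0, -(η / γ (p 0) 0), 0; 0, 0, -(η / γ (p 0) 0)] := by
    have e0 := ((hasPD_warpedMap_zero (h.diff_f hp) (hδ _ hp.1)).congr_on h.isOpen hp hξ).2
    have e1 := ((hasPD_warpedMap_one (h.diff_f hp) (hδ _ hp.1)).congr_on h.isOpen hp hξ).2
    have e2 := ((hasPD_warpedMap_two (h.diff_f hp) (hδ _ hp.1)).congr_on h.isOpen hp hξ).2
    -- The equiaffine condition in the `t` direction makes `δ'` parallel to `γ'`, so `∂ₜ` is an
    -- eigenvector of `S`.
    have hc := h.conormal_pd_normal hp 0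
    rw [e0, conormal_warpedMap, sub_eq_zero] at hc
    have s0 := hcoord (pd 0 ξ p) ![deriv δ (p 0) 0 / deriv γ (p 0) 0, 0, 0, 0] (by
      rw [e0]; ext a
      fin_cases a <;> simp [warpedMap]
      · field_simp
      · field_simp
      · rw [hc]; field_simp
      · field_simp)
    have s1 := hcoord (pd 1 ξ p) ![0, η / γ (p 0) 0, 0, 0] (by
      rw [e1]; ext a
      fin_cases a <;> simp [← hη] <;> field_simp)
    have s2 := hcoord (pd 2 ξ p) ![0, 0, η / γ (p 0) 0, 0] (by
      rw [e2]; ext a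
      fin_cases a <;> simp [← hη] <;> field_simp)
    ext k i
    rw [shape, Matrix.of_apply]
    fin_cases i
    · exact (congrArg Neg.neg (s0 k)).trans (by fin_cases k <;> simp)
    · exact (congrArg Neg.neg (s1 k)).trans (by fin_cases k <;> simp)
    · exact (congrArg Neg.neg (s2 k)).trans (by fin_cases k <;> simp)
  have hmp := hmetric p hp
  rw [← hBdef, ← hAdef, ← hx, ← hy, ← hz] at hmp
  refine exists_basis_Z3_preservesAt (h.posDef.2 p hp) hmp hshape
    -- The coefficients are read off by the number of `t`-slots. `k₁` and `k₂` stay separate, so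
    -- total symmetry of the lowered `K` need not be proved. The denominators `2 * B` appear because
    -- the plane block of `h` already contains `B`.
    (k₀ := A * α - A' / 2) (k₁ := κ - B' / (2 * B)) (k₂ := -(A * η / deriv γ (p 0) 0) + B' / (2 * B))
    (a := ![-(B / 2) * pd 0 (pd 0 (pd 0 f)) ![p 1, p 2], -(B / 2) * pd 0 (pd 0 (pd 1 f)) ![p 1, p 2],
      -(B / 2) * pd 0 (pd 1 (pd 1 f)) ![p 1, p 2], -(B / 2) * pd 1 (pd 1 (pd 1 f)) ![p 1, p 2]])
    ?_ ?_ ?_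
  · intro X Y Z
    have hB0 : B ≠ 0 := div_ne_zero hγ0 hφ0
    rw [metricForm_differenceTensor (h.posDef.1.nondegenerate p hp)]
    · simp only [hΓ, hpd, hmp, Fin.sum_univ_three, Matrix.of_apply, Matrix.cons_val',
        Matrix.cons_val, planeForm, cubicForm]
      field_simp
      ring
    · rw [hmp]
      ext i j
      fin_cases i <;> fin_cases j <;> rfl
  · have := apolar 0
    simp only [Matrix.cons_val]
    linear_combination -(B ^ 2 / 2) * this
  · have := apolar 1
    rw [t1, t2] at this
    simp only [Matrix.cons_val]
    linear_combination -(B ^ 2 / 2) * this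

end IsWarped
end AffineHypersurface

theorem theorem4p4 (N : Set (Fin 2 → ℝ)) (hN : IsOpen N) (f : (Fin 2 → ℝ) → ℝ)
    (hψ : IsImproperAffineSphere (graphMap f) N (fun _ => ![0, 0, 1]))
    (I : Set ℝ) (hI : IsOpen I) (γ : ℝ → (Fin 2 → ℝ)) (hγ : ContDiffOn ℝ ∞ γ I)
    (ξ : (Fin 3 → ℝ) → (Fin 4 → ℝ))
    (hF : IsPositiveDefinite (warpedMap f γ) (productDomain I N) ξ) :
    AdmitsPointwiseSymmetry (warpedMap f γ) (productDomain I N) ξ Z3 ∨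
      AdmitsPointwiseSymmetry (warpedMap f γ) (productDomain I N) ξ SO2 := by
  -- The first alternative holds in every case; no case distinction on the cubic is needed.
  refine Or.inl (IsWarped.admitsPointwiseSymmetry_Z3 ⟨hN, hI,
    contDiffOn_of_graphMap hψ.1.smooth_immersion, hγ, fun q hq => hessian_det_sq hN hψ.1 hq, hF⟩)
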